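/- Let $(X,d)$ be a complete metric space, $u^\ast\in X$, and for every $\varepsilon>0$ let $\phi_\varepsilon\colon X\to(-\infty,+\infty]$ be such that (i) every $\phi_\varepsilon$ is lower semicontinuous; (ii) there exist $C^\ast\in\mathbb R$ and $\tau^\ast>0$ with $\phi_\varepsilon(v)+\frac1{2\tau^\ast}d^2(v,u^\ast)\ge C^\ast$ for all $v\in X$ and all $\varepsilon>0$; (iii) for every $C>0$ there is a compact set $K\subset X$ with $\{v: d^2(v,u^\ast)\le C,\ |\phi_\varepsilon(v)|\le C\}\subset K$ for all $\varepsilon>0$. For $\phi\colon X\to(-\infty,+\infty]$ the (descending) slope is $|\partial\phi|(x)=\limsup_{y\to x}\frac{(\phi(x)-\phi(y))^+}{d(x,y)}$ if $\phi(x)<+\infty$ and $x$ is not isolated, $0$ if $\phi(x)<+\infty$ and $x$ is isolated, and $+\infty$ if $\phi(x)=+\infty$. A curve $u\colon[0,T]\to X$ is in $AC^2([0,T];X)$ if there is $A\in L^2(0,T)$ with $d(u(s),u(t))\le\int_s^tA\,dr$ for $0\le s\le t\le T$; the (a.e.) smallest such $A$ is the metric derivative $|u'|$. A curve of maximal slope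 for $\phi$ in $[0,T]$ is $u\in AC^2([0,T];X)$ for which there is a non-increasing $\varphi\colon[0,T]\to\mathbb R$ with $\varphi=\phi\circ u$ a.e. in $[0,T]$ and $$\varphi(s)-\varphi(t)\ge\frac12\int_s^t|u'|^2(r)\,dr+\frac12\int_s^t|\partial\phi|^2(u(r))\,dr\qquad\text{for all }0\le s\le t\le T.$$ Given $\tau_\varepsilon>0$ with $\tau_\varepsilon\to0$ as $\varepsilon\to0^+$ and $u^0_\varepsilon\in X$, let (for all small $\varepsilon>0$) $u_\varepsilon^{i+1}$ be, recursively, a minimizer over $X$ of $v\mapsto\phi_\varepsilon(v)+\frac1{2\tau_\varepsilon}d^2(v,u^i_\varepsilon)$, and set $\overline u_\varepsilon(0)=u_\varepsilon^0$, $\overline u_\varepsilon(t)=u_\varepsilon^{i+1}$ for $t\in(i\tau_\varepsilon,(i+1)\tau_\varepsilon]$. A minimizing movement along $\phi_\varepsilon$ at scale $\tau_\varepsilon$ with initial data $u^0_\varepsilon$ is any pointwise limit $u\colon[0,+\infty)\to X$ of such a family $\overline u_\varepsilon$ along a sequence $\varepsilon_n\to0^+$. Suppose that $\phi_\varepsilon$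 $\Gamma$-converges to $\phi_0$ with respect to $d$ as $\varepsilon\to0^+$ and that each $\phi_\varepsilon$ has the Slope Cone Property: for every $x$ such that $\phi_\varepsilon(x)$ and $|\partial\phi_\varepsilon|(x)$ are finite, $$\phi_\varepsilon(y)\ge\phi_\varepsilon(x)-d(x,y)\,|\partial\phi_\varepsilon|(x)\qquad\text{for all }y\in X.$$ Let $u^0_\varepsilon\in X$ satisfy $d^2(u^0_\varepsilon,u^\ast)\le S'<+\infty$ and $|\phi_\varepsilon(u^0_\varepsilon)|\le S<+\infty$ for all $\varepsilon>0$. Then, for all families $\tau_\varepsilon>0$ with $\tau_\varepsilon\to0$, every minimizing movement along $\phi_\varepsilon$ at scale $\tau_\varepsilon$ with initial data $u^0_\varepsilon$ is a curve of maximal slope for $\phi_0$ in $[0,T]$, for every $T>0$. Moreover, this applies to convex $\phi_\varepsilon$: if $\psi\colon X\to(-\infty,+\infty]$ is convex, in the sense that any two points $x,y$ with $\psi(x),\psi(y)<+\infty$ are joined by a constant-speed geodesic $\gamma\colon[0,1]\to X$, $\gamma(0)=x$, $\gamma(1)=y$, with $\psi(\gamma(t))\le(1-t)\psi(x)+t\psi(y)$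 for $t\in[0,1]$ (as for usual convex functions on a Banach space, with $\gamma$ the segment), then $\psi$ has the Slope Cone Property. -/

import Mathlib

open Filter Topology MeasureTheory Set
open scoped ENNReal

/-- `v` minimizes `w ↦ φ w + d(w, p)² / (2 τ)` over the whole space. -/
def IsProxStep {X : Type*} [MetricSpace X] (φ : X → EReal) (τ : ℝ) (p v : X) : Prop :=
  ∀ w : X, φ v + ((dist v p ^ 2 / (2 * τ) : ℝ) : EReal)
    ≤ φ w + ((dist w p ^ 2 / (2 * τ) : ℝ) : EReal)

/-- A sequence of successive minimizers with time step `τ`, started at `p`. -/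
def IsDiscreteSolution {X : Type*} [MetricSpace X] (φ : X → EReal) (τ : ℝ) (p : X)
    (w : ℕ → X) : Prop :=
  w 0 = p ∧ ∀ i : ℕ, IsProxStep φ τ (w i) (w (i + 1))

/-- The piecewise-constant interpolation: value `w (i + 1)` on `(i τ, (i + 1) τ]` and
`w 0` at `t = 0`. -/
noncomputable def piecewiseConst {X : Type*} (τ : ℝ) (w : ℕ → X) (t : ℝ) : X :=
  w ⌈t / τ⌉₊

/-- `u` (on `[0, ∞)`) is a minimizing movement along `φ ε` at scale `τ ε` with initial data
`u₀ ε`: the pointwise limit, along some sequence `ε_n → 0⁺`, of a family of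
piecewise-constant interpolations of discrete solutions.  Discrete solutions are only
required for small `ε`, since the minimum problems need only be solvable for small `τ`. -/
def IsMinimizingMovement {X : Type*} [MetricSpace X] (φ : ℝ → X → EReal) (τ : ℝ → ℝ)
    (u₀ : ℝ → X) (u : ℝ → X) : Prop :=
  ∃ w : ℝ → ℕ → X,
    (∀ᶠ ε in 𝓝[>] (0 : ℝ), IsDiscreteSolution (φ ε) (τ ε) (u₀ ε) (w ε)) ∧
    ∃ e : ℕ → ℝ, (∀ n, 0 < e n) ∧ Tendsto e atTop (𝓝 0) ∧
      ∀ t : ℝ, 0 ≤ t →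
        Tendsto (fun n => piecewiseConst (τ (e n)) (w (e n)) t) atTop (𝓝 (u t))

open Classical in
/-- The descending slope of `φ : X → (-∞, +∞]`.  At an isolated point the punctured
neighbourhood filter is `⊥` and the `limsup` in `[0, ∞]` is `0`; `EReal.toENNReal` is the
positive part. -/
noncomputable def descSlope {X : Type*} [MetricSpace X] (φ : X → EReal) (x : X) : ℝ≥0∞ :=
  if φ x = ⊤ then ⊤
  else limsup (fun y => (φ x - φ y).toENNReal / edist x y) (𝓝[≠] x)

/-- `A ∈ L²(0, T)` and `d(v s, v t) ≤ ∫_s^t A` whenever `0 ≤ s ≤ t ≤ T`. -/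
def IsSpeedBound {X : Type*} [MetricSpace X] (T : ℝ) (v : ℝ → X) (A : ℝ → ℝ) : Prop :=
  MemLp A 2 (volume.restrict (Icc 0 T)) ∧
    ∀ s t : ℝ, 0 ≤ s → s ≤ t → t ≤ T → dist (v s) (v t) ≤ ∫ r in s..t, A r

/-- `v ∈ AC²([0, T]; X)`. -/
def IsAC2 {X : Type*} [MetricSpace X] (T : ℝ) (v : ℝ → X) : Prop :=
  ∃ A : ℝ → ℝ, IsSpeedBound T v A

/-- `A` is the metric derivative of `v` on `[0, T]`: the (a.e.) smallest speed bound. -/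
def IsMetricDerivative {X : Type*} [MetricSpace X] (T : ℝ) (v : ℝ → X) (A : ℝ → ℝ) : Prop :=
  IsSpeedBound T v A ∧
    ∀ B : ℝ → ℝ, IsSpeedBound T v B → A ≤ᵐ[volume.restrict (Icc 0 T)] B

/-- `u` is a curve of maximal slope for `φ` in `[0, T]`; here `m` is the metric derivative
`|u'|` and `ϕ` the non-increasing function that agrees a.e. with `φ ∘ u`.  The integrals are
taken in `[0, ∞]`, so the inequality also says that they are finite. -/
def IsCurveOfMaximalSlope {X : Type*} [MetricSpace X] (φ : X → EReal) (T : ℝ)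
    (u : ℝ → X) : Prop :=
  IsAC2 T u ∧
  ∃ m : ℝ → ℝ, IsMetricDerivative T u m ∧
  ∃ ϕ : ℝ → ℝ, AntitoneOn ϕ (Icc 0 T) ∧
    (∀ s t : ℝ, 0 ≤ s → s ≤ t → t ≤ T →
      (1 / 2) * (∫⁻ r in Icc s t, ENNReal.ofReal (m r ^ 2))
        + (1 / 2) * (∫⁻ r in Icc s t, descSlope φ (u r) ^ 2)
        ≤ ENNReal.ofReal (ϕ s - ϕ t)) ∧
    ∀ᵐ t ∂(volume.restrict (Icc 0 T)), φ (u t) = (ϕ t : EReal)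

/-- `φ ε` Γ-converges to `φ₀` as `ε → 0⁺`, with respect to the distance. -/
def GammaConverges {X : Type*} [MetricSpace X] (φ : ℝ → X → EReal) (φ₀ : X → EReal) : Prop :=
  ∀ e : ℕ → ℝ, (∀ n, 0 < e n) → Tendsto e atTop (𝓝 0) →
    (∀ (x : X) (y : ℕ → X), Tendsto y atTop (𝓝 x) →
      φ₀ x ≤ liminf (fun n => φ (e n) (y n)) atTop) ∧
    (∀ x : X, ∃ y : ℕ → X, Tendsto y atTop (𝓝 x) ∧
      limsup (fun n => φ (e n) (y n)) atTop ≤ φ₀ x)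

/-- The Slope Cone Property. -/
def SlopeConeProperty {X : Type*} [MetricSpace X] (φ : X → EReal) : Prop :=
  ∀ x : X, φ x ≠ ⊤ → descSlope φ x ≠ ⊤ →
    ∀ y : X, φ x - ((dist x y * (descSlope φ x).toReal : ℝ) : EReal) ≤ φ y

/-- Convexity in a metric space: any two points of the domain of `φ` are joined by a
constant-speed geodesic along which `φ` lies below the chord. -/
def IsGeodesicallyConvex {X : Type*} [MetricSpace X] (φ : X → EReal) : Prop :=
  ∀ x y : X, φ x ≠ ⊤ → φ y ≠ ⊤ →
    ∃ γ : ℝ → X, γ 0 = x ∧ γ 1 = y ∧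
      (∀ s ∈ Icc (0 : ℝ) 1, ∀ t ∈ Icc (0 : ℝ) 1, dist (γ s) (γ t) = |s - t| * dist x y) ∧
      ∀ t ∈ Icc (0 : ℝ) 1,
        φ (γ t) ≤ ((1 - t : ℝ) : EReal) * φ x + (t : EReal) * φ y

/-- On a normed space every convex function in the usual sense is convex in the sense of
`IsGeodesicallyConvex`, the geodesics being the segments. -/
theorem isGeodesicallyConvex_of_convex {E : Type*} [NormedAddCommGroup E] [NormedSpace ℝ E]
    (φ : E → EReal)
    (h : ∀ x y : E, φ x ≠ ⊤ → φ y ≠ ⊤ → ∀ t ∈ Icc (0 : ℝ) 1,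
      φ ((1 - t) • x + t • y) ≤ ((1 - t : ℝ) : EReal) * φ x + (t : EReal) * φ y) :
    IsGeodesicallyConvex φ := by
  intro x y hx hy
  refine ⟨fun t => (1 - t) • x + t • y, by simp, by simp, ?_, fun t ht => h x y hx hy t ht⟩
  intro s _ t _
  have : ((1 - s) • x + s • y) - ((1 - t) • x + t • y) = (s - t) • (y - x) := by
    module
  rw [dist_eq_norm, this, norm_smul, Real.norm_eq_abs, dist_comm, dist_eq_norm]

/-! The proof compares each discrete solution with De Giorgi's variational interpolation: on a time
step starting at `p`, the point `z r` minimizes `φ + d(·, p)² / (2r)` for the elapsed time `r`. The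
minimal value is monotone in `r`, and its derivative yields an energy inequality with the sharp
factors `1/2`, in which `d(z r, p) / r` dominates the slope at `z r` (`lintegral_prox_le`,
`exists_discrete_interpolation`).

A discrete Gronwall estimate bounds the energies below on bounded time intervals, so Helly's theorem
gives a pointwise limit `ϕ` of the non-increasing discrete energies, and the interpolants converge
to the same curve `u` as the discrete solutions. The Slope Cone Property at the interpolants, tested
on a recovery sequence for an arbitrary `y`, gives `φ₀ y ≥ ϕ t - d(u t, y) · liminf c`, where `c` is
the slope bound. Taking `y = u t`, together with the Γ-liminf inequality, yields `φ₀ (u t) = ϕ t`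
wherever `liminf c` is finite, and the full cone then bounds the slope of `φ₀` by `liminf c`
(`GammaConverges.descSlope_le`).

Fatou's lemma passes the slope integral to the limit. The liminf of the discrete kinetic energies is
superadditive in the time interval and controls squared increments of `u`, hence the integral of the
squared metric derivative (`exists_isMetricDerivative_of_sq_dist_le`).

Convex functions satisfy the cone property because difference quotients along a geodesic dominate
the slope of the chord. -/

/-! ### Monotone and absolutely continuous real functions -/

/-- The total increase of a monotone function over finitely many disjoint subintervals of `[a, b]`
is at most its increase over `[a, b]`. -/
theorem MonotoneOn.sum_sub_le_of_pairwiseDisjoint {G : ℝ → ℝ} {a b : ℝ} (hab : a ≤ b)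
    (hG : MonotoneOn G (Icc a b)) {ι : Type*} (S : Finset ι) (p q : ι → ℝ)
    (hp : ∀ i ∈ S, p i ∈ Icc a b) (hq : ∀ i ∈ S, q i ∈ Icc a b) (hpq : ∀ i ∈ S, p i ≤ q i)
    (hd : (S : Set ι).PairwiseDisjoint fun i => Ioc (p i) (q i)) :
    ∑ i ∈ S, (G (q i) - G (p i)) ≤ G b - G a := by
  -- The intervals need not be ordered: their images span disjoint open intervals inside `[G a, G
  -- b]`, and comparing Lebesgue measures gives the bound.
  have hdisj : (S : Set ι).PairwiseDisjoint fun i => Ioo (G (p i)) (G (q i)) := by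
    intro i hi j hj hij
    have hI := hd hi hj hij
    rw [Function.onFun, Ioc_disjoint_Ioc] at hI
    rw [Function.onFun, Ioo_disjoint_Ioo]
    rcases le_total (q i) (q j) with h1 | h1 <;> rcases le_total (p i) (p j) with h2 | h2 <;>
      simp only [h1, h2, min_eq_left, min_eq_right, max_eq_left, max_eq_right] at hI
    · exact (min_le_left _ _).trans ((hG (hq i hi) (hp j hj) hI).trans (le_max_right _ _))
    · exact (min_le_left _ _).trans ((hG (hq i hi) (hp i hi) hI).trans (le_max_left _ _))
    · exact (min_le_right _ _).trans ((hG (hq j hj) (hp j hj) hI).trans (le_max_right _ _))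
    · exact (min_le_right _ _).trans ((hG (hq j hj) (hp i hi) hI).trans (le_max_left _ _))
  have hsub : (⋃ i ∈ S, Ioo (G (p i)) (G (q i))) ⊆ Icc (G a) (G b) := by
    simp only [iUnion_subset_iff]
    intro i hi x hx
    exact ⟨(hG ⟨le_rfl, hab⟩ (hp i hi) (hp i hi).1).trans hx.1.le,
      hx.2.le.trans (hG (hq i hi) ⟨hab, le_rfl⟩ (hq i hi).2)⟩
  have hm := measure_mono (μ := volume) hsub
  rw [measure_biUnion_finset hdisj (fun _ _ => measurableSet_Ioo)] at hm
  simp only [Real.volume_Ioo, Real.volume_Icc] at hm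
  rw [← ENNReal.ofReal_sum_of_nonneg
    fun i hi => sub_nonneg.2 (hG (hp i hi) (hq i hi) (hpq i hi))] at hm
  exact (ENNReal.ofReal_le_ofReal_iff (sub_nonneg.2 (hG ⟨le_rfl, hab⟩ ⟨hab, le_rfl⟩ hab))).1 hm

/-- A function whose squared increments are controlled by `(t - s) (G t - G s)`, `G` monotone, is
absolutely continuous. -/
theorem absolutelyContinuousOnInterval_of_sq_sub_le {f G : ℝ → ℝ} {a b : ℝ} (hab : a ≤ b)
    (hG : MonotoneOn G (Icc a b))
    (h : ∀ s t, a ≤ s → s ≤ t → t ≤ b → (f t - f s) ^ 2 ≤ (t - s) * (G t - G s)) :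
    AbsolutelyContinuousOnInterval f a b := by
  rw [absolutelyContinuousOnInterval_iff]
  intro ε hε
  have hGab : 0 ≤ G b - G a := sub_nonneg.2 (hG ⟨le_rfl, hab⟩ ⟨hab, le_rfl⟩ hab)
  -- By Cauchy–Schwarz the squared sum of increments is at most total length times `G b - G a`; the
  -- `+ 1` keeps the denominator positive.
  refine ⟨ε ^ 2 / (G b - G a + 1), by positivity, ?_⟩
  rintro ⟨n, I⟩ ⟨hI, hd⟩ hlen
  simp only [uIcc_of_le hab] at hI hd hlen ⊢
  set p : ℕ → ℝ := fun i => min (I i).1 (I i).2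
  set q : ℕ → ℝ := fun i => max (I i).1 (I i).2
  have hp : ∀ i ∈ Finset.range n, p i ∈ Icc a b := fun i hi =>
    ⟨le_min (hI i hi).1.1 (hI i hi).2.1, (min_le_left _ _).trans (hI i hi).1.2⟩
  have hq : ∀ i ∈ Finset.range n, q i ∈ Icc a b := fun i hi =>
    ⟨(hI i hi).1.1.trans (le_max_left _ _), max_le (hI i hi).1.2 (hI i hi).2.2⟩
  have hpq : ∀ i, p i ≤ q i := fun i => min_le_max
  have hsumG := hG.sum_sub_le_of_pairwiseDisjoint hab (Finset.range n) p q hp hq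
    (fun i _ => hpq i) hd
  have hlen' : ∑ i ∈ Finset.range n, (q i - p i) < ε ^ 2 / (G b - G a + 1) := by
    refine lt_of_eq_of_lt (Finset.sum_congr rfl fun i _ => ?_) hlen
    simp only [p, q, Real.dist_eq, max_sub_min_eq_abs']
  have hfd : ∀ i ∈ Finset.range n, dist (f (I i).1) (f (I i).2) ^ 2
      ≤ (q i - p i) * (G (q i) - G (p i)) := by
    intro i hi
    refine le_trans (le_of_eq ?_) (h (p i) (q i) (hp i hi).1 (hpq i) (hq i hi).2)
    rw [Real.dist_eq, sq_abs]
    rcases le_total (I i).1 (I i).2 with h1 | h1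
    · simp only [p, q, min_eq_left h1, max_eq_right h1]
      ring
    · simp only [p, q, min_eq_right h1, max_eq_left h1]
  have hcs : (∑ i ∈ Finset.range n, dist (f (I i).1) (f (I i).2)) ^ 2
      ≤ (∑ i ∈ Finset.range n, (q i - p i)) * ∑ i ∈ Finset.range n, (G (q i) - G (p i)) :=
    Finset.sum_sq_le_sum_mul_sum_of_sq_le_mul _ (fun i _ => sub_nonneg.2 (hpq i))
      (fun i hi => sub_nonneg.2 (hG (hp i hi) (hq i hi) (hpq i))) hfd
  have hlt : (∑ i ∈ Finset.range n, dist (f (I i).1) (f (I i).2)) ^ 2 < ε ^ 2 := by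
    have h0 : 0 ≤ ∑ i ∈ Finset.range n, (q i - p i) :=
      Finset.sum_nonneg fun i _ => sub_nonneg.2 (hpq i)
    rw [lt_div_iff₀ (by positivity)] at hlen'
    nlinarith [mul_le_mul_of_nonneg_left hsumG h0]
  exact lt_of_pow_lt_pow_left₀ 2 hε.le hlt

/-- Fatou's lemma applied to functions converging a.e. to the derivative. Only an inequality can
hold, since `G` may jump. -/
theorem MonotoneOn.lintegral_ofReal_deriv_le {G : ℝ → ℝ} {a b : ℝ} (hab : a ≤ b)
    (hG : MonotoneOn G (Icc a b)) :
    ∫⁻ x in Icc a b, ENNReal.ofReal (deriv G x) ≤ ENNReal.ofReal (G b - G a) := by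
  obtain ⟨g, hg, hgm, hle⟩ := hG.exists_tendsto_deriv_liminf_lintegral_enorm_le hab
  refine le_trans (lintegral_mono fun x => Real.ofReal_le_enorm _) (le_trans ?_ hle)
  exact lintegral_enorm_le_liminf_of_tendsto hg fun n => (hgm n).aemeasurable.enorm

/-! ### Helly's selection theorem -/

theorem exists_subseq_tendsto_of_countable {ι : Type*} [Countable ι] {f : ℕ → ι → ℝ} {C : ℝ}
    (hC : ∀ n i, |f n i| ≤ C) :
    ∃ σ : ℕ → ℕ, StrictMono σ ∧ ∃ g : ι → ℝ, ∀ i,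
      Tendsto (fun n => f (σ n) i) atTop (𝓝 (g i)) := by
  have hK : IsCompact (Set.pi univ fun _ : ι => Icc (-C) C) :=
    isCompact_univ_pi fun _ => isCompact_Icc
  obtain ⟨g, -, σ, hσ, hg⟩ := hK.tendsto_subseq (x := f) fun n i _ => abs_le.1 (hC n i)
  exact ⟨σ, hσ, g, fun i => (tendsto_pi_nhds.1 hg) i⟩

/-- **Helly's selection theorem** for uniformly bounded antitone functions. -/
theorem exists_subseq_tendsto_of_antitone {f : ℕ → ℝ → ℝ} {C : ℝ}
    (hf : ∀ n, Antitone (f n)) (hC : ∀ n t, |f n t| ≤ C) :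
    ∃ σ : ℕ → ℕ, StrictMono σ ∧ ∃ F : ℝ → ℝ, ∀ t,
      Tendsto (fun n => f (σ n) t) atTop (𝓝 (F t)) := by
  obtain ⟨σ, hσ, g, hg⟩ := exists_subseq_tendsto_of_countable
    (f := fun n (q : ℚ) => f n q) (fun n q => hC n q)
  have hle : ∀ t, IsBoundedUnder (· ≤ ·) atTop fun n => f (σ n) t := fun t =>
    isBoundedUnder_of ⟨C, fun n => (abs_le.1 (hC _ t)).2⟩
  have hge : ∀ t, IsBoundedUnder (· ≥ ·) atTop fun n => f (σ n) t := fun t =>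
    isBoundedUnder_of ⟨-C, fun n => (abs_le.1 (hC _ t)).1⟩
  set F : ℝ → ℝ := fun t => limsup (fun n => f (σ n) t) atTop
  have hF : Antitone F := fun s t hst =>
    limsup_le_limsup (Eventually.of_forall fun n => hf _ hst) (hge t).isCoboundedUnder_le (hle s)
  have hFq : ∀ q : ℚ, F q = g q := fun q => (hg q).limsup_eq
  -- The limsup is `F t` by definition; the liminf is bounded below through a rational just to the
  -- right of `t`. The discontinuities of `F` are countable, so a second extraction handles them.
  have hcont : ∀ t, ContinuousAt F t → Tendsto (fun n => f (σ n) t) atTop (𝓝 (F t)) := by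
    intro t ht
    refine tendsto_of_le_liminf_of_limsup_le ?_ le_rfl (hle t) (hge t)
    refine le_of_forall_lt fun c hc => ?_
    obtain ⟨δ, hδ, hball⟩ := Metric.eventually_nhds_iff.1 (ht.eventually (lt_mem_nhds hc))
    obtain ⟨q, hq1, hq2⟩ := exists_rat_btwn (lt_add_of_pos_right t hδ)
    have hcq : c < F q := hball (by rw [Real.dist_eq, abs_lt]; constructor <;> linarith)
    refine hcq.trans_le ?_
    rw [hFq, ← (hg q).liminf_eq]
    exact liminf_le_liminf (Eventually.of_forall fun n => hf _ hq1.le) (hge q)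
      (hle t).isCoboundedUnder_ge
  have : Countable {t | ¬ContinuousAt F t} := hF.countable_not_continuousAt.to_subtype
  obtain ⟨ρ, hρ, k, hk⟩ := exists_subseq_tendsto_of_countable
    (f := fun n (t : {t | ¬ContinuousAt F t}) => f (σ n) t) (fun n t => hC _ t)
  classical
  refine ⟨σ ∘ ρ, hσ.comp hρ, fun t => if h : ContinuousAt F t then F t else k ⟨t, h⟩, fun t => ?_⟩
  by_cases h : ContinuousAt F t
  · simpa [h, Function.comp_def] using (hcont t h).comp hρ.tendsto_atTop
  · simpa [h] using hk ⟨t, h⟩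

section MetricSpace

variable {X : Type*} [MetricSpace X]

/-! ### Arc length and the metric derivative -/

/-- Cauchy–Schwarz along a partition: each distance is at most the geometric mean of a length and an
`H`, and the values of `H` add up to at most the total. -/
theorem sq_sum_dist_le_of_superadditive {T : ℝ} {u : ℝ → X} {H : ℝ → ℝ → ℝ}
    (hnonneg : ∀ s t, 0 ≤ s → s ≤ t → t ≤ T → 0 ≤ H s t)
    (hsuper : ∀ r s t, 0 ≤ r → r ≤ s → s ≤ t → t ≤ T → H r s + H s t ≤ H r t)
    (hdist : ∀ s t, 0 ≤ s → s ≤ t → t ≤ T → dist (u s) (u t) ^ 2 ≤ (t - s) * H s t)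
    {I : ℕ → ℝ} (hI : Monotone I) (h0 : ∀ i, 0 ≤ I i) (hT : ∀ i, I i ≤ T) (n : ℕ) :
    (∑ i ∈ Finset.range n, dist (u (I i)) (u (I (i + 1)))) ^ 2
      ≤ (I n - I 0) * H (I 0) (I n) := by
  induction n with
  | zero => simp
  | succ n ih =>
    rw [Finset.sum_range_succ]
    set A := ∑ i ∈ Finset.range n, dist (u (I i)) (u (I (i + 1)))
    have hA : 0 ≤ A := Finset.sum_nonneg fun _ _ => dist_nonneg
    set B := dist (u (I n)) (u (I (n + 1)))
    have hB : 0 ≤ B := dist_nonneg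
    have hBd : B ^ 2 ≤ _ := hdist (I n) (I (n + 1)) (h0 _) (hI n.le_succ) (hT _)
    have hs := hsuper (I 0) (I n) (I (n + 1)) (h0 _) (hI n.zero_le) (hI n.le_succ) (hT _)
    have hg1 := hnonneg (I 0) (I n) (h0 _) (hI n.zero_le) (hT _)
    have hg2 := hnonneg (I n) (I (n + 1)) (h0 _) (hI n.le_succ) (hT _)
    have hh1 : 0 ≤ I n - I 0 := sub_nonneg.2 (hI n.zero_le)
    have hh2 : 0 ≤ I (n + 1) - I n := sub_nonneg.2 (hI n.le_succ)
    have key : 2 * (A * B) ≤ (I n - I 0) * H (I n) (I (n + 1))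
        + (I (n + 1) - I n) * H (I 0) (I n) := by
      apply le_of_sq_le_sq _ (by positivity)
      have : A ^ 2 * B ^ 2 ≤ ((I n - I 0) * H (I 0) (I n))
          * ((I (n + 1) - I n) * H (I n) (I (n + 1))) :=
        mul_le_mul ih hBd (by positivity) (by positivity)
      nlinarith [sq_nonneg ((I n - I 0) * H (I n) (I (n + 1))
        - (I (n + 1) - I n) * H (I 0) (I n))]
    calc (A + B) ^ 2 ≤ (I n - I 0 + (I (n + 1) - I n)) * (H (I 0) (I n) + H (I n) (I (n + 1))) := by
          nlinarith
      _ ≤ _ := by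
          rw [show I n - I 0 + (I (n + 1) - I n) = I (n + 1) - I 0 by ring]
          exact mul_le_mul_of_nonneg_left hs (by linarith)

theorem eVariationOn_le_of_superadditive {T : ℝ} {u : ℝ → X} {H : ℝ → ℝ → ℝ}
    (hnonneg : ∀ s t, 0 ≤ s → s ≤ t → t ≤ T → 0 ≤ H s t)
    (hsuper : ∀ r s t, 0 ≤ r → r ≤ s → s ≤ t → t ≤ T → H r s + H s t ≤ H r t)
    (hdist : ∀ s t, 0 ≤ s → s ≤ t → t ≤ T → dist (u s) (u t) ^ 2 ≤ (t - s) * H s t)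
    {s t : ℝ} (hs : 0 ≤ s) (hst : s ≤ t) (ht : t ≤ T) :
    eVariationOn u (Icc s t) ≤ ENNReal.ofReal (√((t - s) * H s t)) := by
  refine iSup_le ?_
  rintro ⟨n, I, hI, hIm⟩
  have key := sq_sum_dist_le_of_superadditive hnonneg hsuper hdist hI
    (fun i => hs.trans (hIm i).1) (fun i => (hIm i).2.trans ht) n
  simp only [edist_comm (u (I (_ + 1))), edist_dist]
  rw [← ENNReal.ofReal_sum_of_nonneg fun _ _ => dist_nonneg]
  refine ENNReal.ofReal_le_ofReal (Real.le_sqrt_of_sq_le (key.trans ?_))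
  have h1 := hsuper s (I 0) (I n) hs (hIm 0).1 (hI n.zero_le) ((hIm n).2.trans ht)
  have h2 := hsuper s (I n) t hs (hIm n).1 (hIm n).2 ht
  have h3 := hnonneg s (I 0) hs (hIm 0).1 ((hIm 0).2.trans ht)
  have h4 := hnonneg (I n) t (hs.trans (hIm n).1) (hIm n).2 ht
  have h5 := hnonneg (I 0) (I n) (hs.trans (hIm 0).1) (hI n.zero_le) ((hIm n).2.trans ht)
  exact mul_le_mul (by linarith [(hIm 0).1, (hIm n).2]) (by linarith) h5 (by linarith)

theorem eVariationOn_le_integral_of_dist_le {T : ℝ} {u : ℝ → X} {B : ℝ → ℝ}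
    (hB : IntegrableOn B (Icc 0 T))
    (hdist : ∀ s t, 0 ≤ s → s ≤ t → t ≤ T → dist (u s) (u t) ≤ ∫ r in s..t, B r)
    {s t : ℝ} (hs : 0 ≤ s) (ht : t ≤ T) :
    eVariationOn u (Icc s t) ≤ ENNReal.ofReal (∫ r in s..t, B r) := by
  have hint : ∀ p q, 0 ≤ p → p ≤ q → q ≤ T → IntervalIntegrable B volume p q :=
    fun p q hp hpq hq => (intervalIntegrable_iff_integrableOn_Icc_of_le hpq).2
      (hB.mono_set (Icc_subset_Icc hp hq))
  refine iSup_le ?_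
  rintro ⟨n, I, hI, hIm⟩
  have h0 : ∀ i, 0 ≤ I i := fun i => hs.trans (hIm i).1
  have hT : ∀ i, I i ≤ T := fun i => (hIm i).2.trans ht
  simp only [edist_comm (u (I (_ + 1))), edist_dist]
  rw [← ENNReal.ofReal_sum_of_nonneg fun _ _ => dist_nonneg]
  apply ENNReal.ofReal_le_ofReal
  have h1 : ∑ i ∈ Finset.range n, dist (u (I i)) (u (I (i + 1))) ≤ ∫ r in I 0..I n, B r := by
    rw [← intervalIntegral.sum_integral_adjacent_intervals
      fun k _ => hint _ _ (h0 k) (hI k.le_succ) (hT _)]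
    exact Finset.sum_le_sum fun i _ => hdist _ _ (h0 i) (hI i.le_succ) (hT _)
  have h2 := dist_nonneg.trans (hdist s (I 0) hs (hIm 0).1 (hT 0))
  have h3 := dist_nonneg.trans (hdist (I n) t (h0 n) (hIm n).2 ht)
  have i1 := hint s (I 0) hs (hIm 0).1 (hT 0)
  have i2 := hint (I 0) (I n) (h0 0) (hI n.zero_le) (hT n)
  have i3 := hint (I n) t (h0 n) (hIm n).2 ht
  have e1 := intervalIntegral.integral_add_adjacent_intervals i1 i2
  have e2 := intervalIntegral.integral_add_adjacent_intervals (i1.trans i2) i3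
  linarith

/-- Divide by `(y - x) ^ 2` and let `y` decrease to `x`. -/
theorem sq_deriv_le_deriv_of_sq_sub_le {f G : ℝ → ℝ} {x b : ℝ} (hxb : x < b)
    (hf : DifferentiableAt ℝ f x) (hG : DifferentiableAt ℝ G x)
    (h : ∀ y, x < y → y ≤ b → (f y - f x) ^ 2 ≤ (y - x) * (G y - G x)) :
    deriv f x ^ 2 ≤ deriv G x := by
  have h1 := (hf.hasDerivAt.tendsto_slope).mono_left (nhdsGT_le_nhdsNE x)
  have h2 := (hG.hasDerivAt.tendsto_slope).mono_left (nhdsGT_le_nhdsNE x)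
  refine le_of_tendsto_of_tendsto (h1.pow 2) h2 ?_
  filter_upwards [Ioc_mem_nhdsGT hxb] with y hy
  have hy' : 0 < y - x := sub_pos.2 hy.1
  rw [slope_def_field, slope_def_field, div_pow, div_le_div_iff₀ (by positivity) hy']
  nlinarith [h y hy.1 hy.2]

/-- A curve whose squared increments are controlled by `(t - s) H(s, t)`, with `H` superadditive,
has a metric derivative, and `H` bounds the integral of its square. -/
theorem exists_isMetricDerivative_of_sq_dist_le {T : ℝ} (hT : 0 < T) {u : ℝ → X} {H : ℝ → ℝ → ℝ}
    (hnonneg : ∀ s t, 0 ≤ s → s ≤ t → t ≤ T → 0 ≤ H s t)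
    (hsuper : ∀ r s t, 0 ≤ r → r ≤ s → s ≤ t → t ≤ T → H r s + H s t ≤ H r t)
    (hdist : ∀ s t, 0 ≤ s → s ≤ t → t ≤ T → dist (u s) (u t) ^ 2 ≤ (t - s) * H s t) :
    ∃ m, IsMetricDerivative T u m ∧ ∀ s t, 0 ≤ s → s ≤ t → t ≤ T →
      ∫⁻ r in Icc s t, ENNReal.ofReal (m r ^ 2) ≤ ENNReal.ofReal (H s t) := by
  have hvar : ∀ s t, 0 ≤ s → s ≤ t → t ≤ T →
      eVariationOn u (Icc s t) ≤ ENNReal.ofReal (√((t - s) * H s t)) := fun s t hs hst ht =>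
    eVariationOn_le_of_superadditive hnonneg hsuper hdist hs hst ht
  have hfin : ∀ s t, 0 ≤ s → s ≤ t → t ≤ T → eVariationOn u (Icc s t) ≠ ⊤ :=
    fun s t hs hst ht => ne_top_of_le_ne_top ENNReal.ofReal_ne_top (hvar s t hs hst ht)
  -- Arc length inherits the bound on squared increments, so it is absolutely continuous; its
  -- derivative is the metric derivative.
  set l : ℝ → ℝ := fun t => (eVariationOn u (Icc 0 t)).toReal
  have hl : ∀ s t, 0 ≤ s → s ≤ t → t ≤ T → l t - l s = (eVariationOn u (Icc s t)).toReal := by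
    intro s t hs hst ht
    have := eVariationOn.Icc_add_Icc u hs hst (mem_univ s)
    simp only [univ_inter] at this
    simp only [l]
    rw [← this, ENNReal.toReal_add (hfin 0 s le_rfl hs (hst.trans ht)) (hfin s t hs hst ht)]
    ring
  have hlmono : MonotoneOn l (Icc 0 T) := fun s hs t ht hst => by
    have := hl s t hs.1 hst ht.2
    linarith [ENNReal.toReal_nonneg (a := eVariationOn u (Icc s t))]
  have hldist : ∀ s t, 0 ≤ s → s ≤ t → t ≤ T → dist (u s) (u t) ≤ l t - l s := by
    intro s t hs hst ht
    rw [hl s t hs hst ht, ← ENNReal.ofReal_le_iff_le_toReal (hfin s t hs hst ht), ← edist_dist]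
    exact eVariationOn.edist_le u ⟨le_rfl, hst⟩ ⟨hst, le_rfl⟩
  have hlsq : ∀ s t, 0 ≤ s → s ≤ t → t ≤ T → (l t - l s) ^ 2 ≤ (t - s) * H s t := by
    intro s t hs hst ht
    have h1 : l t - l s ≤ √((t - s) * H s t) := by
      rw [hl s t hs hst ht]
      exact ENNReal.toReal_le_of_le_ofReal (Real.sqrt_nonneg _) (hvar s t hs hst ht)
    have h0 : 0 ≤ l t - l s := dist_nonneg.trans (hldist s t hs hst ht)
    calc (l t - l s) ^ 2 ≤ √((t - s) * H s t) ^ 2 := pow_le_pow_left₀ h0 h1 2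
      _ = _ := Real.sq_sqrt (mul_nonneg (sub_nonneg.2 hst) (hnonneg s t hs hst ht))
  have hHmono : ∀ s, 0 ≤ s → MonotoneOn (H s) (Icc s T) := fun s hs p hp q hq hpq => by
    linarith [hsuper s p q hs hp.1 hpq hq.2, hnonneg p q (hs.trans hp.1) hpq hq.2]
  have hlac : AbsolutelyContinuousOnInterval l 0 T := by
    refine absolutelyContinuousOnInterval_of_sq_sub_le hT.le (hHmono 0 le_rfl) ?_
    intro s t hs hst ht
    refine (hlsq s t hs hst ht).trans (mul_le_mul_of_nonneg_left ?_ (sub_nonneg.2 hst))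
    linarith [hsuper 0 s t le_rfl hs hst ht]
  have hlint : ∀ s t, 0 ≤ s → s ≤ t → t ≤ T → ∫ r in s..t, deriv l r = l t - l s := by
    intro s t hs hst ht
    refine (hlac.mono ?_).integral_deriv_eq_sub
    rw [uIcc_of_le hst, uIcc_of_le hT.le]
    exact Icc_subset_Icc hs ht
  have hldiff : ∀ᵐ x, x ∈ Icc 0 T → DifferentiableAt ℝ l x := by
    have := hlac.ae_differentiableAt
    rwa [uIcc_of_le hT.le] at this
  have hsq : ∀ s t, 0 ≤ s → s ≤ t → t ≤ T →
      ∫⁻ r in Icc s t, ENNReal.ofReal (deriv l r ^ 2) ≤ ENNReal.ofReal (H s t) := by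
    intro s t hs hst ht
    have hmono : MonotoneOn (H s) (Icc s t) := (hHmono s hs).mono (Icc_subset_Icc le_rfl ht)
    refine le_trans ?_ ((hmono.lintegral_ofReal_deriv_le hst).trans
      (ENNReal.ofReal_le_ofReal (by linarith [hnonneg s s hs le_rfl (hst.trans ht)])))
    refine lintegral_mono_ae ?_
    rw [← restrict_Ioo_eq_restrict_Icc, ae_restrict_iff' measurableSet_Ioo]
    filter_upwards [hldiff, hmono.ae_differentiableWithinAt_of_mem] with x hx1 hx2 hx
    have hxs := hs.trans hx.1.le
    refine ENNReal.ofReal_le_ofReal (sq_deriv_le_deriv_of_sq_sub_le hx.2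
      (hx1 ⟨hxs, hx.2.le.trans ht⟩)
      ((hx2 ⟨hx.1.le, hx.2.le⟩).differentiableAt (Icc_mem_nhds hx.1 hx.2)) ?_)
    intro y hxy hyt
    refine (hlsq x y hxs hxy.le (hyt.trans ht)).trans
      (mul_le_mul_of_nonneg_left ?_ (sub_nonneg.2 hxy.le))
    -- Superadditivity bounds `H x y` by the increment of `H s` over `[x, y]`, so `deriv l ^ 2 ≤
    -- deriv (H s)` a.e.
    linarith [hsuper s x y hs hx.1.le hxy.le (hyt.trans ht)]
  refine ⟨deriv l, ⟨⟨?_, fun s t hs hst ht =>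
    (hldist s t hs hst ht).trans_eq (hlint s t hs hst ht).symm⟩, ?_⟩, hsq⟩
  · refine ⟨(measurable_deriv l).aestronglyMeasurable, ?_⟩
    rw [eLpNorm_lt_top_iff_lintegral_rpow_enorm_lt_top (by norm_num) (by norm_num)]
    refine lt_of_eq_of_lt (lintegral_congr fun r => ?_)
      ((hsq 0 T le_rfl hT.le le_rfl).trans_lt ENNReal.ofReal_lt_top)
    rw [← sq_abs, ENNReal.ofReal_pow (abs_nonneg _), Real.enorm_eq_ofReal_abs]
    norm_num
  · rintro B ⟨hBL, hB⟩
    have hBint : IntegrableOn B (Icc 0 T) := hBL.integrable (by norm_num)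
    have hBI : IntervalIntegrable B volume 0 T :=
      (intervalIntegrable_iff_integrableOn_Icc_of_le hT.le).2 hBint
    -- Minimality: the integral of any speed bound `B` dominates the variation of `u`, so its
    -- primitive minus `l` is monotone and has nonnegative derivative.
    have hmono : MonotoneOn (fun t => (∫ r in (0 : ℝ)..t, B r) - l t) (Icc 0 T) := by
      intro s hs t ht hst
      have h1 : l t - l s ≤ ∫ r in s..t, B r := by
        rw [hl s t hs.1 hst ht.2]
        exact ENNReal.toReal_le_of_le_ofReal (dist_nonneg.trans (hB s t hs.1 hst ht.2))
          (eVariationOn_le_integral_of_dist_le hBint hB hs.1 ht.2)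
      have h2 := intervalIntegral.integral_add_adjacent_intervals
        (hBI.mono_set (by rw [uIcc_of_le hs.1, uIcc_of_le hT.le]; exact Icc_subset_Icc le_rfl hs.2))
        (hBI.mono_set (a := 0) (b := T) (c := s) (d := t)
          (by rw [uIcc_of_le hst, uIcc_of_le hT.le]; exact Icc_subset_Icc hs.1 ht.2))
      simp only
      linarith
    rw [EventuallyLE, ← restrict_Ioo_eq_restrict_Icc, ae_restrict_iff' measurableSet_Ioo]
    filter_upwards [hldiff, hBI.ae_hasDerivAt_integral] with x hx1 hx2 hx
    have hxI : x ∈ uIcc 0 T := by rw [uIcc_of_le hT.le]; exact Ioo_subset_Icc_self hx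
    have hd := (hx2 hxI 0 (by simp)).sub (hx1 (Ioo_subset_Icc_self hx)).hasDerivAt
    have h0 := hmono.derivWithin_nonneg (x := x)
    rw [derivWithin_of_mem_nhds (Icc_mem_nhds hx.1 hx.2)] at h0
    have h1 := hd.deriv
    have h2 : deriv (fun t => (∫ r in (0 : ℝ)..t, B r) - l t) x = B x - deriv l x := h1
    linarith

/-! ### Slopes and cones -/

theorem descSlope_le_of_eventually {φ : X → EReal} {x : X} {α c : ℝ} (hc : 0 ≤ c)
    (hx : φ x = α) (h : ∀ᶠ y in 𝓝 x, ((α - dist x y * c : ℝ) : EReal) ≤ φ y) :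
    descSlope φ x ≤ ENNReal.ofReal c := by
  rw [descSlope, if_neg (by simp [hx])]
  refine limsup_le_of_le (h := ?_)
  filter_upwards [h.filter_mono nhdsWithin_le_nhds] with y hy
  refine ENNReal.div_le_of_le_mul ?_
  rw [hx, edist_dist, ← ENNReal.ofReal_mul hc]
  induction hφ : φ y with
  | bot => exact absurd (le_bot_iff.1 (hφ ▸ hy)) (EReal.coe_ne_bot _)
  | top => simp
  | coe β =>
    rw [hφ, EReal.coe_le_coe_iff] at hy
    rw [← EReal.coe_sub, EReal.toENNReal_of_ne_top (EReal.coe_ne_top _), EReal.toReal_coe]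
    exact ENNReal.ofReal_le_ofReal (by linarith)

/-- Along the geodesic towards `y`, every difference quotient at `x` is at least `(ψ x - ψ y) / d(x,
y)`, and so is their limsup. -/
theorem slopeConeProperty_of_isGeodesicallyConvex {ψ : X → EReal} (hbot : ∀ x, ψ x ≠ ⊥)
    (hψ : IsGeodesicallyConvex ψ) : SlopeConeProperty ψ := by
  intro x hx hslope y
  by_cases hy : ψ y = ⊤
  · simp [hy]
  rcases eq_or_ne x y with rfl | hxy
  · simp
  obtain ⟨γ, h0, -, hγ, hconv⟩ := hψ x y hx hy
  lift ψ x to ℝ using ⟨hx, hbot x⟩ with α hα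
  lift ψ y to ℝ using ⟨hy, hbot y⟩ with β hβ
  have hD : 0 < dist x y := dist_pos.2 hxy
  have hdist : ∀ t ∈ Icc (0 : ℝ) 1, dist x (γ t) = t * dist x y := by
    intro t ht
    have := hγ 0 ⟨le_rfl, zero_le_one⟩ t ht
    rwa [h0, zero_sub, abs_neg, abs_of_nonneg ht.1] at this
  have hev : ∀ᶠ t in 𝓝[>] (0 : ℝ), t ∈ Ioo (0 : ℝ) 1 := Ioo_mem_nhdsGT zero_lt_one
  have htend : Tendsto γ (𝓝[>] 0) (𝓝[≠] x) := by
    refine tendsto_nhdsWithin_iff.2 ⟨?_, ?_⟩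
    · rw [tendsto_iff_dist_tendsto_zero]
      have h1 : Tendsto (fun t : ℝ => t * dist x y) (𝓝[>] 0) (𝓝 0) := by
        have : Tendsto (fun t : ℝ => t * dist x y) (𝓝 0) (𝓝 (0 * dist x y)) :=
          tendsto_id.mul_const _
        rw [zero_mul] at this
        exact this.mono_left nhdsWithin_le_nhds
      refine h1.congr' ?_
      filter_upwards [hev] with t ht
      rw [dist_comm (γ t), hdist t (Ioo_subset_Icc_self ht)]
    · filter_upwards [hev] with t ht
      have : 0 < dist x (γ t) := by
        rw [hdist t (Ioo_subset_Icc_self ht)]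
        exact mul_pos ht.1 hD
      exact (dist_pos.1 this).symm
  have hle : ENNReal.ofReal ((α - β) / dist x y) ≤ descSlope ψ x := by
    rw [descSlope, if_neg (by rw [← hα]; simp)]
    refine le_limsup_of_frequently_le (htend.frequently (Eventually.frequently ?_))
    filter_upwards [hev] with t ht
    have htI := Ioo_subset_Icc_self ht
    have hc := hconv t htI
    have hpos : 0 < t * dist x y := mul_pos ht.1 hD
    rw [← EReal.coe_mul, ← EReal.coe_mul, ← EReal.coe_add] at hc
    lift ψ (γ t) to ℝ using ⟨ne_top_of_le_ne_top (EReal.coe_ne_top _) hc, hbot _⟩ with c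
    rw [EReal.coe_le_coe_iff] at hc
    rw [← hα, ← EReal.coe_sub, EReal.toENNReal_of_ne_top (EReal.coe_ne_top _), EReal.toReal_coe,
      edist_dist, hdist t htI, ENNReal.le_div_iff_mul_le (Or.inl (by simpa using hpos))
      (Or.inl ENNReal.ofReal_ne_top), ← ENNReal.ofReal_mul' hpos.le]
    refine ENNReal.ofReal_le_ofReal ?_
    have : (α - β) / dist x y * (t * dist x y) = t * (α - β) := by field_simp
    rw [this]
    linarith
  rw [ENNReal.ofReal_le_iff_le_toReal hslope, div_le_iff₀ hD] at hle
  rw [← EReal.coe_sub, EReal.coe_le_coe_iff]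
  linarith

/-! ### Stability of slopes and energies under Γ-convergence -/

section Closure

variable {φ : ℝ → X → EReal} {φ₀ : X → EReal} {e : ℕ → ℝ} {x : X} {v v' : ℕ → X}
  {a a' : ℕ → ℝ} {α : ℝ} {s : ℕ → ℝ≥0∞}

/-- The cone inequality passes to the Γ-limit. -/
theorem GammaConverges.cone_le (hΓ : GammaConverges φ φ₀) (he : ∀ n, 0 < e n)
    (he0 : Tendsto e atTop (𝓝 0)) (hcone : ∀ n, SlopeConeProperty (φ (e n)))
    (hv : Tendsto v atTop (𝓝 x)) (ha : ∀ n, φ (e n) (v n) = a n) (haa : ∀ n, a' n ≤ a n)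
    (hα : Tendsto a' atTop (𝓝 α)) (hs : ∀ n, descSlope (φ (e n)) (v n) ≤ s n)
    (hfin : liminf s atTop ≠ ⊤) (y : X) :
    ((α - dist x y * (liminf s atTop).toReal : ℝ) : EReal) ≤ φ₀ y := by
  -- The recovery sequence for `y` is taken along a subsequence realizing the liminf of the slope
  -- bounds.
  obtain ⟨k, hks, hk⟩ := exists_seq_tendsto_liminf (u := s) (f := atTop)
  obtain ⟨z, hz, hlim⟩ := (hΓ (e ∘ k) (fun n => he _) (he0.comp hk)).2 y
  have hb : Tendsto (fun j => (s (k j)).toReal) atTop (𝓝 (liminf s atTop).toReal) :=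
    (ENNReal.tendsto_toReal hfin).comp hks
  have htend : Tendsto (fun j => ((a' (k j) - dist (v (k j)) (z j) * (s (k j)).toReal : ℝ) : EReal))
      atTop (𝓝 ((α - dist x y * (liminf s atTop).toReal : ℝ) : EReal)) :=
    (continuous_coe_real_ereal.tendsto _).comp
      ((hα.comp hk).sub (((hv.comp hk).dist hz).mul hb))
  refine le_trans ?_ hlim
  rw [← htend.limsup_eq]
  refine limsup_le_limsup ?_
  have hlt : ∀ᶠ j in atTop, s (k j) < ⊤ := hks.eventually (gt_mem_nhds hfin.lt_top)
  filter_upwards [hlt] with j hj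
  refine le_trans ?_ (hcone (k j) (v (k j)) (by simp [ha])
    (ne_top_of_le_ne_top hj.ne (hs _)) (z j))
  rw [ha, ← EReal.coe_sub, EReal.coe_le_coe_iff]
  have h1 := ENNReal.toReal_mono hj.ne (hs (k j))
  have h2 := mul_le_mul_of_nonneg_left h1 (dist_nonneg (x := v (k j)) (y := z j))
  linarith [haa (k j)]

/-- The cone inequality at its vertex gives `φ₀ x ≥ α`, and the Γ-liminf inequality along `v'` gives
the converse. The energies `a` along `v` need not converge: only `a' ≤ a` is needed. -/
theorem GammaConverges.eq_of_tendsto (hΓ : GammaConverges φ φ₀) (he : ∀ n, 0 < e n)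
    (he0 : Tendsto e atTop (𝓝 0)) (hcone : ∀ n, SlopeConeProperty (φ (e n)))
    (hv : Tendsto v atTop (𝓝 x)) (hv' : Tendsto v' atTop (𝓝 x))
    (ha : ∀ n, φ (e n) (v n) = a n) (ha' : ∀ n, φ (e n) (v' n) = a' n) (haa : ∀ n, a' n ≤ a n)
    (hα : Tendsto a' atTop (𝓝 α)) (hs : ∀ n, descSlope (φ (e n)) (v n) ≤ s n)
    (hfin : liminf s atTop ≠ ⊤) : φ₀ x = α := by
  refine le_antisymm ?_ (by simpa using hΓ.cone_le he he0 hcone hv ha haa hα hs hfin x)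
  refine ((hΓ e he he0).1 x v' hv').trans_eq ?_
  simp only [ha']
  exact ((continuous_coe_real_ereal.tendsto _).comp hα).liminf_eq

theorem GammaConverges.descSlope_le (hΓ : GammaConverges φ φ₀) (he : ∀ n, 0 < e n)
    (he0 : Tendsto e atTop (𝓝 0)) (hcone : ∀ n, SlopeConeProperty (φ (e n)))
    (hv : Tendsto v atTop (𝓝 x)) (hv' : Tendsto v' atTop (𝓝 x))
    (ha : ∀ n, φ (e n) (v n) = a n) (ha' : ∀ n, φ (e n) (v' n) = a' n) (haa : ∀ n, a' n ≤ a n)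
    (hα : Tendsto a' atTop (𝓝 α)) (hs : ∀ n, descSlope (φ (e n)) (v n) ≤ s n) :
    descSlope φ₀ x ≤ liminf s atTop := by
  by_cases hfin : liminf s atTop = ⊤
  · simp [hfin]
  rw [← ENNReal.ofReal_toReal hfin]
  exact descSlope_le_of_eventually ENNReal.toReal_nonneg
    (hΓ.eq_of_tendsto he he0 hcone hv hv' ha ha' haa hα hs hfin)
    (Eventually.of_forall (hΓ.cone_le he he0 hcone hv ha haa hα hs hfin))

end Closure

/-! ### One minimization step -/

theorem dist_sq_le_two_mul_add (x y z : X) :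
    dist x z ^ 2 ≤ 2 * dist x y ^ 2 + 2 * dist y z ^ 2 := by
  nlinarith [dist_triangle x y z, sq_nonneg (dist x y - dist y z), dist_nonneg (x := x) (y := z)]

theorem IsProxStep.exists_eq_coe {φ : X → EReal} {τ : ℝ} {p v : X} (hbot : ∀ x, φ x ≠ ⊥)
    {α : ℝ} (hp : φ p = α) (h : IsProxStep φ τ p v) :
    ∃ β : ℝ, φ v = β ∧ β + dist v p ^ 2 / (2 * τ) ≤ α := by
  have h1 := h p
  rw [hp, ← EReal.coe_add] at h1
  have hv : φ v ≠ ⊤ := by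
    intro hv
    rw [hv, EReal.top_add_coe] at h1
    exact EReal.coe_ne_top _ (top_le_iff.1 h1)
  lift φ v to ℝ using ⟨hv, hbot v⟩ with β
  refine ⟨β, rfl, ?_⟩
  rw [← EReal.coe_add, EReal.coe_le_coe_iff] at h1
  simpa using h1

theorem IsProxStep.le_of_eq_coe {φ : X → EReal} {τ : ℝ} {p v w : X} (h : IsProxStep φ τ p v)
    {β γ : ℝ} (hv : φ v = β) (hw : φ w = γ) :
    β + dist v p ^ 2 / (2 * τ) ≤ γ + dist w p ^ 2 / (2 * τ) := by
  have h1 := h w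
  rwa [hv, hw, ← EReal.coe_add, ← EReal.coe_add, EReal.coe_le_coe_iff] at h1

/-- Testing minimality with `y` near `v` bounds `φ v - φ y` by `d(v, y) · d(v, p) / τ` plus `d(v,
y)² / (2τ)`; the last term is at most `δ · d(v, y)` within radius `2τδ`. -/
theorem IsProxStep.descSlope_le {φ : X → EReal} {τ : ℝ} (hτ : 0 < τ) {p v : X} {β : ℝ}
    (hv : φ v = β) (h : IsProxStep φ τ p v) :
    descSlope φ v ≤ ENNReal.ofReal (dist v p / τ) := by
  refine ENNReal.le_of_forall_pos_le_add fun δ hδ _ => ?_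
  have hδ' : (0 : ℝ) < δ := by exact_mod_cast hδ
  rw [← ENNReal.ofReal_coe_nnreal (p := δ), ← ENNReal.ofReal_add (by positivity) hδ'.le]
  refine descSlope_le_of_eventually (by positivity) hv ?_
  filter_upwards [Metric.ball_mem_nhds v (show 0 < 2 * τ * δ by positivity)] with y hy
  rw [Metric.mem_ball, dist_comm] at hy
  induction hφ : φ y with
  | bot =>
    have h1 := h y
    rw [hφ, EReal.bot_add, hv, ← EReal.coe_add] at h1
    exact absurd (le_bot_iff.1 h1) (EReal.coe_ne_bot _)
  | top => exact le_top
  | coe γ =>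
    have h1 := h.le_of_eq_coe hv hφ
    rw [EReal.coe_le_coe_iff]
    have h2 : dist y p ≤ dist v y + dist v p := by
      rw [dist_comm v y]; exact dist_triangle y v p
    have h3 : dist y p ^ 2 ≤ (dist v y + dist v p) ^ 2 := pow_le_pow_left₀ dist_nonneg h2 2
    have h4 : (dist y p ^ 2 - dist v p ^ 2) / (2 * τ) ≤ dist v y * (dist v p / τ + δ) := by
      rw [div_le_iff₀ (by positivity)]
      have : dist v y * (dist v p / τ + δ) * (2 * τ)
          = dist v y * (2 * dist v p + 2 * τ * δ) := by field_simp
      rw [this]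
      nlinarith [dist_nonneg (x := v) (y := y)]
    rw [sub_div] at h4
    linarith

/-- Existence of minimizers of `v ↦ φ v + d(v, p)² / (2 r)` for small `r`. -/
theorem exists_isProxStep {φ : X → EReal} {ustar : X} (hlsc : LowerSemicontinuous φ)
    (hbot : ∀ x, φ x ≠ ⊥) {Cstar τstar : ℝ} (hτs : 0 < τstar)
    (hbound : ∀ v : X, (Cstar : EReal) ≤ φ v + ((dist v ustar ^ 2 / (2 * τstar) : ℝ) : EReal))
    (hcompact : ∀ C : ℝ, 0 < C → ∃ K : Set X, IsCompact K ∧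
      {v : X | dist v ustar ^ 2 ≤ C ∧ ((-C : ℝ) : EReal) ≤ φ v ∧ φ v ≤ (C : EReal)} ⊆ K)
    {p : X} {α : ℝ} (hp : φ p = α) {r : ℝ} (hr : 0 < r) (hr4 : r ≤ τstar / 4) :
    ∃ z, IsProxStep φ r p z := by
  -- `M` bounds `d²(v, ustar)` on the sublevel set `F v ≤ α`: since `r ≤ τstar / 4`, the quadratic
  -- penalty outweighs the quadratic loss in the lower bound. `C` then controls distance and energy
  -- together.
  set M : ℝ := 2 * τstar * (α - Cstar) + 4 * dist p ustar ^ 2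
  set C : ℝ := |M| + |α| + |Cstar - M / (2 * τstar)| + 1
  obtain ⟨K, hK, hsub⟩ := hcompact C (by positivity)
  set F : X → EReal := fun v => φ v + ((dist v p ^ 2 / (2 * r) : ℝ) : EReal)
  have hFp : F p = α := by simp [F, hp]
  have hFK : ∀ v, F v ≤ α → v ∈ K := by
    intro v hv
    have hvt : φ v ≠ ⊤ := by
      intro h
      simp only [F] at hv
      rw [h, EReal.top_add_coe] at hv
      exact EReal.coe_ne_top _ (top_le_iff.1 hv)
    apply hsub
    have hb := hbound v
    simp only [F] at hv
    simp only [mem_ofPred_eq]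
    lift φ v to ℝ using ⟨hvt, hbot v⟩ with β
    rw [← EReal.coe_add, EReal.coe_le_coe_iff] at hv hb
    have h1 := dist_sq_le_two_mul_add v p ustar
    have h2 : 2 * dist v p ^ 2 / τstar ≤ dist v p ^ 2 / (2 * r) := by
      rw [div_le_div_iff₀ hτs (by positivity)]
      nlinarith [sq_nonneg (dist v p)]
    have h3 : dist v ustar ^ 2 / (2 * τstar) ≤ (dist v p ^ 2 + dist p ustar ^ 2) / τstar := by
      rw [div_le_div_iff₀ (by positivity) hτs]
      nlinarith
    have h4 : dist v p ^ 2 ≤ τstar * (α - Cstar) + dist p ustar ^ 2 := by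
      have h5 : 2 * dist v p ^ 2 / τstar - (dist v p ^ 2 + dist p ustar ^ 2) / τstar
          ≤ α - Cstar := by linarith
      rw [← sub_div, div_le_iff₀ hτs] at h5
      linarith
    have hM : dist v ustar ^ 2 ≤ M := by simp only [M]; linarith
    have hM' : dist v ustar ^ 2 / (2 * τstar) ≤ M / (2 * τstar) := by gcongr
    have hq : 0 ≤ dist v p ^ 2 / (2 * r) := by positivity
    have e1 := le_abs_self M
    have e2 := le_abs_self α
    have e3 := neg_abs_le (Cstar - M / (2 * τstar))
    have n1 := abs_nonneg M
    have n2 := abs_nonneg α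
    have n3 := abs_nonneg (Cstar - M / (2 * τstar))
    refine ⟨by simp only [C]; linarith, ?_, ?_⟩ <;> rw [EReal.coe_le_coe_iff] <;>
      simp only [C] <;> linarith
  have hFlsc : LowerSemicontinuous F := by
    refine LowerSemicontinuous.add' hlsc ?_ ?_
    · have : Continuous fun v => ((dist v p ^ 2 / (2 * r) : ℝ) : EReal) :=
        continuous_coe_real_ereal.comp (by fun_prop)
      exact this.lowerSemicontinuous
    · intro x
      exact EReal.continuousAt_add (Or.inr (EReal.coe_ne_bot _)) (Or.inr (EReal.coe_ne_top _))
  obtain ⟨z, -, hz⟩ := LowerSemicontinuousOn.exists_isMinOn ⟨p, hFK p hFp.le⟩ hK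
    (hFlsc.lowerSemicontinuousOn K)
  refine ⟨z, fun w => ?_⟩
  by_cases hw : w ∈ K
  · exact hz hw
  · have h1 : α < F w := not_le.1 fun h => hw (hFK w h)
    have h2 : F z ≤ F p := hz (hFK p hFp.le)
    exact h2.trans (hFp.le.trans h1.le)

/-! ### De Giorgi's variational interpolation of one step -/

section RealInterpolation

variable {a d : ℝ → ℝ} {α τ : ℝ}

/-- Adding the minimality inequalities at `r` and `r'` cancels the energies. -/
theorem monotoneOn_of_prox (hd : ∀ r, 0 ≤ d r)
    (h : ∀ r ∈ Ioc 0 τ, ∀ r' ∈ Ioc 0 τ,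
      a r + d r ^ 2 / (2 * r) ≤ a r' + d r' ^ 2 / (2 * r)) : MonotoneOn d (Ioc 0 τ) := by
  intro r hr r' hr' hrr
  rcases hrr.eq_or_lt with rfl | hlt
  · rfl
  have h1 := h r hr r' hr'
  have h2 := h r' hr' r hr
  have hr0 := hr.1
  have hr0' := hr'.1
  have hk : 0 < 1 / (2 * r) - 1 / (2 * r') := by
    rw [sub_pos]
    exact one_div_lt_one_div_of_lt (by linarith) (by linarith)
  have h3 : d r ^ 2 * (1 / (2 * r) - 1 / (2 * r')) ≤ d r' ^ 2 * (1 / (2 * r) - 1 / (2 * r')) := by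
    simp only [mul_sub, mul_one_div]
    linarith
  exact le_of_sq_le_sq (le_of_mul_le_mul_right h3 hk) (hd r')

theorem antitoneOn_of_prox (hd : ∀ r, 0 ≤ d r)
    (h : ∀ r ∈ Ioc 0 τ, ∀ r' ∈ Ioc 0 τ,
      a r + d r ^ 2 / (2 * r) ≤ a r' + d r' ^ 2 / (2 * r)) : AntitoneOn a (Ioc 0 τ) := by
  intro r hr r' hr' hrr
  have h1 := h r' hr' r hr
  have h2 : d r ^ 2 / (2 * r') ≤ d r' ^ 2 / (2 * r') := by
    have := hr'.1
    have := pow_le_pow_left₀ (hd r) (monotoneOn_of_prox hd h hr hr' hrr) 2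
    gcongr
  linarith

/-- The integrated form of De Giorgi's derivative formula for the Moreau–Yosida regularization. -/
theorem lintegral_prox_le (hτ : 0 < τ) (h0 : ∀ r ∈ Ioc 0 τ, a r + d r ^ 2 / (2 * r) ≤ α)
    (h : ∀ r ∈ Ioc 0 τ, ∀ r' ∈ Ioc 0 τ,
      a r + d r ^ 2 / (2 * r) ≤ a r' + d r' ^ 2 / (2 * r)) :
    ENNReal.ofReal (d τ ^ 2 / (2 * τ))
      + (1 / 2) * ∫⁻ r in Ioc 0 τ, ENNReal.ofReal (d r / r) ^ 2 ≤ ENNReal.ofReal (α - a τ) := by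
  -- `g` is minus the Moreau–Yosida value, extended by `-α` at `r = 0`, where a jump is allowed.
  set g : ℝ → ℝ := fun r => if r ≤ 0 then -α else -(a r + d r ^ 2 / (2 * r))
  have hgpos : ∀ r, 0 < r → g r = -(a r + d r ^ 2 / (2 * r)) := fun r hr => if_neg (not_le.2 hr)
  have hg0 : g 0 = -α := if_pos le_rfl
  -- The minimizer for `x` is a competitor for `y`; dividing by `y - x` gives `g' ≥ d² / (2x²)` a.e.
  have hinc : ∀ x y, 0 < x → x < y → y ≤ τ → d x ^ 2 / (2 * x * y) * (y - x) ≤ g y - g x := by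
    intro x y hx hxy hy
    have hy0 : 0 < y := hx.trans hxy
    have h1 := h y ⟨hy0, hy⟩ x ⟨hx, hxy.le.trans hy⟩
    have h2 : d x ^ 2 / (2 * x * y) * (y - x) = d x ^ 2 / (2 * x) - d x ^ 2 / (2 * y) := by
      field_simp
    rw [hgpos x hx, hgpos y hy0, h2]
    linarith
  have hmono : MonotoneOn g (Icc 0 τ) := by
    intro x hx y hy hxy
    rcases hxy.eq_or_lt with rfl | hlt
    · rfl
    rcases hx.1.eq_or_lt with rfl | hx0
    · rw [hg0, hgpos y hlt]
      linarith [h0 y ⟨hlt, hy.2⟩]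
    · have h1 := hinc x y hx0 hlt hy.2
      have h2 : 0 ≤ d x ^ 2 / (2 * x * y) * (y - x) :=
        mul_nonneg (div_nonneg (sq_nonneg _) (by nlinarith)) (by linarith)
      linarith
  have hint : (1 / 2) * ∫⁻ r in Ioc 0 τ, ENNReal.ofReal (d r / r) ^ 2
      ≤ ENNReal.ofReal (g τ - g 0) := by
    rw [← lintegral_const_mul' _ _ (by simp)]
    refine le_trans ?_ (hmono.lintegral_ofReal_deriv_le hτ.le)
    rw [← restrict_Ioo_eq_restrict_Ioc, ← restrict_Ioo_eq_restrict_Icc]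
    refine lintegral_mono_ae ?_
    rw [ae_restrict_iff' measurableSet_Ioo]
    filter_upwards [hmono.ae_differentiableWithinAt_of_mem] with x hx1 hx
    have hdx := ((hx1 (Ioo_subset_Icc_self hx)).differentiableAt
      (Icc_mem_nhds hx.1 hx.2)).hasDerivAt
    have hx0 := hx.1
    have hlim : Tendsto (fun y => d x ^ 2 / (2 * x * y)) (𝓝[>] x) (𝓝 (d x ^ 2 / (2 * x * x))) := by
      refine Tendsto.mono_left ?_ nhdsWithin_le_nhds
      exact tendsto_const_nhds.div (tendsto_const_nhds.mul tendsto_id) (by positivity)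
    have hle : d x ^ 2 / (2 * x * x) ≤ deriv g x := by
      refine le_of_tendsto_of_tendsto hlim (hdx.tendsto_slope.mono_left (nhdsGT_le_nhdsNE x)) ?_
      filter_upwards [Ioc_mem_nhdsGT hx.2] with y hy
      rw [slope_def_field, le_div_iff₀ (sub_pos.2 hy.1)]
      exact hinc x y hx0 hy.1 hy.2
    have h12 : (1 / 2 : ℝ≥0∞) = ENNReal.ofReal (1 / 2) := by
      rw [ENNReal.ofReal_div_of_pos two_pos]; simp
    have hsq : ENNReal.ofReal (d x / x) ^ 2 ≤ ENNReal.ofReal ((d x / x) ^ 2) := by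
      rw [← sq_abs, ENNReal.ofReal_pow (abs_nonneg _)]
      exact pow_le_pow_left' (ENNReal.ofReal_le_ofReal (le_abs_self _)) 2
    refine (mul_le_mul_right hsq _).trans ?_
    rw [h12, ← ENNReal.ofReal_mul (by norm_num)]
    refine ENNReal.ofReal_le_ofReal (le_trans (le_of_eq ?_) hle)
    field_simp
  have hg0τ : 0 ≤ g τ - g 0 := sub_nonneg.2 (hmono ⟨le_rfl, hτ.le⟩ ⟨hτ.le, le_rfl⟩ hτ.le)
  refine (add_le_add_right hint _).trans ?_
  rw [← ENNReal.ofReal_add (by positivity) hg0τ]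
  refine ENNReal.ofReal_le_ofReal ?_
  rw [hg0, hgpos τ hτ]
  linarith

end RealInterpolation

/-- De Giorgi's variational interpolation of one step of the minimization scheme. -/
theorem exists_variational_interpolation {φ : X → EReal} {ustar : X} (hlsc : LowerSemicontinuous φ)
    (hbot : ∀ x, φ x ≠ ⊥) {Cstar τstar : ℝ} (hτs : 0 < τstar)
    (hbound : ∀ v : X, (Cstar : EReal) ≤ φ v + ((dist v ustar ^ 2 / (2 * τstar) : ℝ) : EReal))
    (hcompact : ∀ C : ℝ, 0 < C → ∃ K : Set X, IsCompact K ∧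
      {v : X | dist v ustar ^ 2 ≤ C ∧ ((-C : ℝ) : EReal) ≤ φ v ∧ φ v ≤ (C : EReal)} ⊆ K)
    {p q : X} {α β τ : ℝ} (hp : φ p = α) (hq : φ q = β) (hτ : 0 < τ) (hτ4 : τ ≤ τstar / 4)
    (hpq : IsProxStep φ τ p q) :
    ∃ (z : ℝ → X) (b : ℝ → ℝ) (c : ℝ → ℝ≥0∞), Measurable c ∧
      (∀ r ∈ Ioc 0 τ, φ (z r) = b r ∧ β ≤ b r ∧ dist (z r) p ≤ dist q p ∧
        descSlope φ (z r) ≤ c r) ∧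
      ENNReal.ofReal (dist q p ^ 2 / (2 * τ)) + (1 / 2) * ∫⁻ r in Ioc 0 τ, c r ^ 2
        ≤ ENNReal.ofReal (α - β) := by
  -- Minimizers need not be unique, so the choice at `r = τ` is forced to be the given point `q`.
  have hex : ∀ r, ∃ z, (r ∈ Ioc 0 τ → IsProxStep φ r p z) ∧ (r = τ → z = q) := by
    intro r
    rcases eq_or_ne r τ with rfl | hr
    · exact ⟨q, fun _ => hpq, fun _ => rfl⟩
    by_cases hrI : r ∈ Ioc 0 τ
    · obtain ⟨z, hz⟩ := exists_isProxStep hlsc hbot hτs hbound hcompact hp hrI.1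
        (hrI.2.trans hτ4)
      exact ⟨z, fun _ => hz, fun h => absurd h hr⟩
    · exact ⟨q, fun h => absurd h hrI, fun _ => rfl⟩
  choose z hz hzτ using hex
  have hzq : z τ = q := hzτ τ rfl
  have hb : ∀ r, ∃ b : ℝ, r ∈ Ioc 0 τ → φ (z r) = b ∧ b + dist (z r) p ^ 2 / (2 * r) ≤ α := by
    intro r
    by_cases hr : r ∈ Ioc 0 τ
    · obtain ⟨b, hb⟩ := (hz r hr).exists_eq_coe hbot hp
      exact ⟨b, fun _ => hb⟩
    · exact ⟨0, fun h => absurd h hr⟩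
  choose b hb using hb
  have hτI : τ ∈ Ioc 0 τ := ⟨hτ, le_rfl⟩
  have hbτ : b τ = β := by
    have := (hb τ hτI).1
    rw [hzq, hq] at this
    exact_mod_cast this.symm
  have hprox : ∀ r ∈ Ioc 0 τ, ∀ r' ∈ Ioc 0 τ,
      b r + dist (z r) p ^ 2 / (2 * r) ≤ b r' + dist (z r') p ^ 2 / (2 * r) :=
    fun r hr r' hr' => (hz r hr).le_of_eq_coe (hb r hr).1 (hb r' hr').1
  have hd : ∀ r, 0 ≤ dist (z r) p := fun r => dist_nonneg
  have hmono := monotoneOn_of_prox hd hprox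
  have hanti := antitoneOn_of_prox hd hprox
  -- The selection `z` may be non-measurable, but its distance to `p` is monotone; the monotone
  -- extension `D` makes the slope bound `D r / r` measurable.
  set D : ℝ → ℝ := fun r => if r ≤ 0 then 0 else dist (z (min r τ)) p
  have hD : ∀ r ∈ Ioc 0 τ, D r = dist (z r) p := fun r hr => by
    simp only [D, if_neg (not_le.2 hr.1), min_eq_left hr.2]
  have hDmono : Monotone D := by
    intro r r' hrr
    simp only [D]
    split_ifs with h1 h2 h2
    · rfl
    · exact dist_nonneg
    · linarith
    · exact hmono ⟨lt_min (not_le.1 h1) hτ, min_le_right _ _⟩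
        ⟨lt_min (not_le.1 h2) hτ, min_le_right _ _⟩ (min_le_min_right _ hrr)
  refine ⟨z, b, fun r => ENNReal.ofReal (D r / r),
    (hDmono.measurable.div measurable_id).ennreal_ofReal, fun r hr => ⟨(hb r hr).1, ?_, ?_, ?_⟩, ?_⟩
  · rw [← hbτ]; exact hanti hr hτI hr.2
  · rw [← hzq]; exact hmono hr hτI hr.2
  · beta_reduce; rw [hD r hr]; exact (hz r hr).descSlope_le hr.1 (hb r hr).1
  · have key := lintegral_prox_le hτ (fun r hr => (hb r hr).2) hprox
    rw [hzq, hbτ] at key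
    rw [setLIntegral_congr_fun measurableSet_Ioc
      fun r hr => show ENNReal.ofReal (D r / r) ^ 2 = ENNReal.ofReal (dist (z r) p / r) ^ 2 by
        rw [hD r hr]]
    exact key

/-! ### Energy estimates and interpolation for discrete solutions -/

theorem IsDiscreteSolution.exists_energy {φ : X → EReal} {τ : ℝ} {p : X} {w : ℕ → X}
    (hbot : ∀ x, φ x ≠ ⊥) {α : ℝ} (hp : φ p = α) (h : IsDiscreteSolution φ τ p w) :
    ∃ f : ℕ → ℝ, (∀ i, φ (w i) = f i) ∧
      ∀ i, f (i + 1) + dist (w (i + 1)) (w i) ^ 2 / (2 * τ) ≤ f i := by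
  have hfin : ∀ i, ∃ a : ℝ, φ (w i) = a := by
    intro i
    induction i with
    | zero => exact ⟨α, by rw [h.1, hp]⟩
    | succ i ih =>
      obtain ⟨a, ha⟩ := ih
      obtain ⟨b, hb, -⟩ := (h.2 i).exists_eq_coe hbot ha
      exact ⟨b, hb⟩
  choose f hf using hfin
  refine ⟨f, hf, fun i => ?_⟩
  simpa using (h.2 i).le_of_eq_coe (hf (i + 1)) (hf i)

/-- Discrete Gronwall estimate: a lower bound for the energy along a discrete solution. -/
theorem energy_lower_bound {f : ℕ → ℝ} {w : ℕ → X} {ustar : X} {τ τstar Cstar : ℝ} (hτ : 0 < τ)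
    (hτ4 : τ ≤ τstar / 4)
    (hstep : ∀ i, f (i + 1) + dist (w (i + 1)) (w i) ^ 2 / (2 * τ) ≤ f i)
    (hbound : ∀ i, Cstar ≤ f i + dist (w i) ustar ^ 2 / (2 * τstar)) (N : ℕ) :
    Cstar - Real.exp (N * (8 * τ / τstar)) * (f 0 + dist (w 0) ustar ^ 2 / τstar - Cstar)
      ≤ f N := by
  have hτs : 0 < τstar := by linarith
  -- The weight `1 / τstar`, twice that of the lower bound, makes `E` control the squared distance
  -- to `ustar`.
  set E : ℕ → ℝ := fun i => f i + dist (w i) ustar ^ 2 / τstar - Cstar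
  have hE : ∀ i, dist (w i) ustar ^ 2 / (2 * τstar) ≤ E i := fun i => by
    have h1 := hbound i
    have h2 : dist (w i) ustar ^ 2 / τstar = 2 * (dist (w i) ustar ^ 2 / (2 * τstar)) := by
      field_simp
    simp only [E]
    linarith
  have hE0 : ∀ i, 0 ≤ E i := fun i => le_trans (by positivity) (hE i)
  have hrec : ∀ i, E (i + 1) ≤ Real.exp (8 * τ / τstar) * E i := by
    intro i
    have h1 := hstep i
    set d := dist (w (i + 1)) (w i)
    set D := dist (w i) ustar
    have hd : 0 ≤ d := dist_nonneg
    have hD : 0 ≤ D := dist_nonneg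
    have h2 : dist (w (i + 1)) ustar ^ 2 ≤ (d + D) ^ 2 :=
      pow_le_pow_left₀ dist_nonneg (dist_triangle _ _ _) 2
    have h3 : dist (w (i + 1)) ustar ^ 2 / τstar ≤ (d + D) ^ 2 / τstar := by gcongr
    -- The kinetic term absorbs the cross term by completing the square `(4τD - τstar d)²`; this
    -- uses `τ ≤ τstar / 4`.
    have h4 : (d + D) ^ 2 / τstar - D ^ 2 / τstar - d ^ 2 / (2 * τ)
        ≤ 8 * τ / τstar * (D ^ 2 / (2 * τstar)) := by
      have e : 8 * τ / τstar * (D ^ 2 / (2 * τstar))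
          - ((d + D) ^ 2 / τstar - D ^ 2 / τstar - d ^ 2 / (2 * τ))
          = (8 * τ ^ 2 * D ^ 2 - 4 * τ * τstar * d * D + d ^ 2 * τstar * (τstar - 2 * τ))
            / (2 * τ * τstar ^ 2) := by
        field_simp
        ring
      rw [← sub_nonneg, e]
      refine div_nonneg ?_ (by positivity)
      have h5 : τstar / 2 ≤ τstar - 2 * τ := by linarith
      have h6 : d ^ 2 * τstar * (τstar / 2) ≤ d ^ 2 * τstar * (τstar - 2 * τ) :=
        mul_le_mul_of_nonneg_left h5 (by positivity)
      nlinarith [sq_nonneg (4 * τ * D - τstar * d)]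
    have h7 := mul_le_mul_of_nonneg_left (hE i) (show 0 ≤ 8 * τ / τstar by positivity)
    have h8 := mul_le_mul_of_nonneg_right (Real.add_one_le_exp (8 * τ / τstar)) (hE0 i)
    have h9 : E (i + 1) ≤ E i + 8 * τ / τstar * E i := by
      simp only [E] at h7 ⊢
      linarith
    linarith
  have hall : E N ≤ Real.exp (N * (8 * τ / τstar)) * E 0 := by
    induction N with
    | zero => simp
    | succ N ih =>
      refine (hrec N).trans ?_
      rw [Nat.cast_succ, add_mul, one_mul, Real.exp_add, mul_comm (Real.exp _) (Real.exp _),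
        mul_assoc]
      exact mul_le_mul_of_nonneg_left ih (Real.exp_pos _).le
  have h1 := hbound N
  have h2 := hE N
  linarith

theorem ceil_div_eq_succ_iff {τ t : ℝ} (hτ : 0 < τ) (i : ℕ) :
    ⌈t / τ⌉₊ = i + 1 ↔ t ∈ Ioc (i * τ) (((i + 1 : ℕ) : ℝ) * τ) := by
  rw [Nat.ceil_eq_iff (show i + 1 ≠ 0 by lia), Nat.add_sub_cancel, lt_div_iff₀ hτ, div_le_iff₀ hτ,
    mem_Ioc]

/-- De Giorgi's variational interpolation of a discrete solution. -/
theorem exists_discrete_interpolation {φ : X → EReal} {ustar : X} (hlsc : LowerSemicontinuous φ)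
    (hbot : ∀ x, φ x ≠ ⊥) {Cstar τstar : ℝ} (hτs : 0 < τstar)
    (hbound : ∀ v : X, (Cstar : EReal) ≤ φ v + ((dist v ustar ^ 2 / (2 * τstar) : ℝ) : EReal))
    (hcompact : ∀ C : ℝ, 0 < C → ∃ K : Set X, IsCompact K ∧
      {v : X | dist v ustar ^ 2 ≤ C ∧ ((-C : ℝ) : EReal) ≤ φ v ∧ φ v ≤ (C : EReal)} ⊆ K)
    {τ : ℝ} (hτ : 0 < τ) (hτ4 : τ ≤ τstar / 4) {p : X} {w : ℕ → X} {f : ℕ → ℝ}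
    (hw : IsDiscreteSolution φ τ p w) (hf : ∀ i, φ (w i) = f i)
    (hstep : ∀ i, f (i + 1) + dist (w (i + 1)) (w i) ^ 2 / (2 * τ) ≤ f i) :
    ∃ (Z : ℝ → X) (b : ℝ → ℝ) (c : ℝ → ℝ≥0∞), Measurable c ∧
      (∀ t, 0 < t → φ (Z t) = b t ∧ f ⌈t / τ⌉₊ ≤ b t ∧ descSlope φ (Z t) ≤ c t ∧
        dist (Z t) (w ⌈t / τ⌉₊) ≤ 2 * dist (w ⌈t / τ⌉₊) (w (⌈t / τ⌉₊ - 1))) ∧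
      ∀ j k : ℕ, j ≤ k →
        ∑ i ∈ Finset.Ico j k, ENNReal.ofReal (dist (w (i + 1)) (w i) ^ 2 / (2 * τ))
          + (1 / 2) * ∫⁻ t in Ioc (j * τ) (k * τ), c t ^ 2 ≤ ENNReal.ofReal (f j - f k) := by
  choose z b c hcm hprop hen using fun i => exists_variational_interpolation hlsc hbot hτs hbound
    hcompact (hf i) (hf (i + 1)) hτ hτ4 (hw.2 i)
  -- `I t` is the index of the step containing `t` and `R t` the time elapsed in it; with intervals
  -- open on the left, `R t` lies in `(0, τ]`.
  set I : ℝ → ℕ := fun t => ⌈t / τ⌉₊ - 1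
  set R : ℝ → ℝ := fun t => t - I t * τ
  have hIm : Measurable I :=
    (measurable_from_top (f := fun n : ℕ => n - 1)).comp
      (Nat.measurable_ceil.comp (measurable_id.div_const τ))
  have hRm : Measurable R :=
    measurable_id.sub (((measurable_from_top (f := fun n : ℕ => (n : ℝ))).comp hIm).mul_const τ)
  have hval : ∀ i : ℕ, ∀ t ∈ Ioc (i * τ) (((i + 1 : ℕ) : ℝ) * τ), I t = i := by
    intro i t ht
    simp only [I, (ceil_div_eq_succ_iff hτ i).2 ht, Nat.add_sub_cancel]
  refine ⟨fun t => z (I t) (R t), fun t => b (I t) (R t), fun t => c (I t) (R t), ?_, ?_, ?_⟩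
  · have h1 : Measurable fun x : ℝ × ℕ => c x.2 x.1 :=
      measurable_from_prod_countable_left fun i => hcm i
    exact h1.comp (hRm.prodMk hIm)
  · intro t ht
    obtain ⟨i, hi⟩ : ∃ i, ⌈t / τ⌉₊ = i + 1 :=
      Nat.exists_eq_succ_of_ne_zero (Nat.ceil_pos.2 (div_pos ht hτ)).ne'
    have hti := (ceil_div_eq_succ_iff hτ i).1 hi
    have hIt := hval i t hti
    have hR : R t ∈ Ioc 0 τ := by
      simp only [R, hIt]
      have := hti.2
      push_cast at this
      constructor <;> linarith [hti.1]
    obtain ⟨h1, h2, h3, h4⟩ := hprop i (R t) hR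
    simp only [hIt, hi, Nat.add_sub_cancel]
    refine ⟨h1, h2, h4, (dist_triangle_right _ _ (w i)).trans ?_⟩
    linarith
  · intro j k hjk
    induction k, hjk using Nat.le_induction with
    | base => simp
    | succ k hjk ih =>
      have hmono : ∀ i, f (i + 1) ≤ f i := fun i => le_trans (le_add_of_nonneg_right
        (by positivity)) (hstep i)
      have hfjk : f k ≤ f j := antitone_nat_of_succ_le hmono hjk
      have hk1 : (k : ℝ) * τ ≤ ((k + 1 : ℕ) : ℝ) * τ := by push_cast; nlinarith
      have hjk' : (j : ℝ) * τ ≤ (k : ℝ) * τ := by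
        have : (j : ℝ) ≤ k := by exact_mod_cast hjk
        gcongr
      have hshift : ∫⁻ t in Ioc ((k : ℝ) * τ) (((k + 1 : ℕ) : ℝ) * τ), c (I t) (R t) ^ 2
          = ∫⁻ r in Ioc 0 τ, c k r ^ 2 := by
        have h1 := (measurePreserving_sub_right volume ((k : ℝ) * τ)).setLIntegral_comp_preimage_emb
          (measurableEmbedding_subRight _) (fun r => c k r ^ 2) (Ioc 0 τ)
        rw [← h1, preimage_sub_const_Ioc, zero_add,
          show τ + k * τ = ((k + 1 : ℕ) : ℝ) * τ by push_cast; ring]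
        refine setLIntegral_congr_fun measurableSet_Ioc fun t ht => ?_
        simp only [R, hval k t ht]
      have hdisj : Disjoint (Ioc ((j : ℝ) * τ) (k * τ)) (Ioc (k * τ) (((k + 1 : ℕ) : ℝ) * τ)) :=
        Ioc_disjoint_Ioc_of_le le_rfl
      rw [Finset.sum_Ico_succ_top hjk, ← Ioc_union_Ioc_eq_Ioc hjk' hk1,
        lintegral_union measurableSet_Ioc hdisj, hshift, mul_add, add_add_add_comm]
      refine (add_le_add ih (hen k)).trans_eq ?_
      rw [← ENNReal.ofReal_add (by linarith) (by linarith [hmono k])]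
      congr 1
      ring

/-! ### Discrete action and passage to the limit -/

theorem ENNReal.liminf_add_liminf_le (a b : ℕ → ℝ≥0∞) :
    liminf a atTop + liminf b atTop ≤ liminf (fun n => a n + b n) atTop := by
  simp only [liminf_eq_iSup_iInf_of_nat]
  refine ENNReal.iSup_add_iSup_le fun i j => ?_
  refine le_iSup_of_le (max i j) (le_iInf₂ fun n hn => ?_)
  exact add_le_add (iInf₂_le n ((le_max_left _ _).trans hn))
    (iInf₂_le n ((le_max_right _ _).trans hn))

theorem ENNReal.mul_liminf_le (k : ℝ≥0∞) (a : ℕ → ℝ≥0∞) :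
    k * liminf a atTop ≤ liminf (fun n => k * a n) atTop := by
  simp only [liminf_eq_iSup_iInf_of_nat, ENNReal.mul_iSup]
  exact iSup_mono fun i => le_iInf₂ fun n hn => mul_le_mul_right (iInf₂_le n hn) _

theorem ENNReal.liminf_sq_le (a : ℕ → ℝ≥0∞) :
    (liminf a atTop) ^ 2 ≤ liminf (fun n => a n ^ 2) atTop :=
  (Monotone.map_liminf_of_continuousAt (f := fun x : ℝ≥0∞ => x ^ 2) (pow_left_mono 2) a
    (ENNReal.continuous_pow 2).continuousAt).le

theorem tendsto_ceil_div_mul {τ : ℕ → ℝ} (hτ : ∀ n, 0 < τ n) (hτ0 : Tendsto τ atTop (𝓝 0))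
    {t : ℝ} (ht : 0 ≤ t) : Tendsto (fun n => (⌈t / τ n⌉₊ : ℝ) * τ n) atTop (𝓝 t) := by
  refine tendsto_of_tendsto_of_tendsto_of_le_of_le tendsto_const_nhds
    (h := fun n => t + τ n) (by simpa using tendsto_const_nhds.add hτ0) (fun n => ?_) fun n => ?_
  · exact (div_le_iff₀ (hτ n)).1 (Nat.le_ceil _)
  · have h1 := mul_le_mul_of_nonneg_right (Nat.ceil_lt_add_one (div_nonneg ht (hτ n).le)).le
      (hτ n).le
    rwa [add_mul, one_mul, div_mul_cancel₀ _ (hτ n).ne'] at h1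

/-- The cumulated kinetic energy of a discrete solution between the times `s` and `t`. -/
noncomputable def discreteAction (τ : ℝ) (w : ℕ → X) (s t : ℝ) : ℝ≥0∞ :=
  ∑ i ∈ Finset.Ico ⌈s / τ⌉₊ ⌈t / τ⌉₊, ENNReal.ofReal (dist (w (i + 1)) (w i) ^ 2 / (2 * τ))

theorem ceil_div_mono {τ : ℝ} (hτ : 0 < τ) {s t : ℝ} (hst : s ≤ t) : ⌈s / τ⌉₊ ≤ ⌈t / τ⌉₊ :=
  Nat.ceil_mono (div_le_div_of_nonneg_right hst hτ.le)

theorem discreteAction_add {τ : ℝ} (hτ : 0 < τ) (w : ℕ → X) {r s t : ℝ} (hrs : r ≤ s)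
    (hst : s ≤ t) :
    discreteAction τ w r s + discreteAction τ w s t = discreteAction τ w r t :=
  Finset.sum_Ico_consecutive _ (ceil_div_mono hτ hrs) (ceil_div_mono hτ hst)

/-- Cauchy–Schwarz over the steps: their number times `τ` is the elapsed grid time. -/
theorem sq_dist_piecewiseConst_le {τ : ℝ} (hτ : 0 < τ) (w : ℕ → X) {s t : ℝ} (hst : s ≤ t) :
    dist (piecewiseConst τ w s) (piecewiseConst τ w t) ^ 2
      ≤ (⌈t / τ⌉₊ * τ - ⌈s / τ⌉₊ * τ) * (2 * (discreteAction τ w s t).toReal) := by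
  have hle := ceil_div_mono hτ hst
  have h1 := pow_le_pow_left₀ dist_nonneg (dist_le_Ico_sum_dist w hle) 2
  refine h1.trans (sq_sum_le_card_mul_sum_sq.trans (le_of_eq ?_))
  rw [discreteAction, ← ENNReal.ofReal_sum_of_nonneg fun _ _ => by positivity,
    ENNReal.toReal_ofReal (Finset.sum_nonneg fun _ _ => by positivity), ← Finset.sum_div,
    Nat.card_Ico, Nat.cast_sub hle]
  simp only [dist_comm (w (_ + 1))]
  field_simp

/-- Passage to the limit in the discrete energy inequality. -/
theorem isCurveOfMaximalSlope_of_tendsto {φ : ℝ → X → EReal} {φ₀ : X → EReal}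
    (hΓ : GammaConverges φ φ₀) {e : ℕ → ℝ} (he : ∀ n, 0 < e n) (he0 : Tendsto e atTop (𝓝 0))
    (hcone : ∀ n, SlopeConeProperty (φ (e n))) {τ : ℕ → ℝ} (hτ : ∀ n, 0 < τ n)
    (hτ0 : Tendsto τ atTop (𝓝 0)) {w : ℕ → ℕ → X} {f : ℕ → ℕ → ℝ}
    (hf : ∀ n i, φ (e n) (w n i) = f n i)
    (hstep : ∀ n i, f n (i + 1) + dist (w n (i + 1)) (w n i) ^ 2 / (2 * τ n) ≤ f n i)
    {T S L : ℝ} (hT : 0 < T) (hS : ∀ n, f n 0 ≤ S) (hL : ∀ n, ∀ t ∈ Icc 0 T, L ≤ f n ⌈t / τ n⌉₊)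
    {Z : ℕ → ℝ → X} {b : ℕ → ℝ → ℝ} {c : ℕ → ℝ → ℝ≥0∞} (hc : ∀ n, Measurable (c n))
    (hZ : ∀ n t, 0 < t → φ (e n) (Z n t) = b n t ∧ f n ⌈t / τ n⌉₊ ≤ b n t ∧
      descSlope (φ (e n)) (Z n t) ≤ c n t ∧
      dist (Z n t) (w n ⌈t / τ n⌉₊) ≤ 2 * dist (w n ⌈t / τ n⌉₊) (w n (⌈t / τ n⌉₊ - 1)))
    (hen : ∀ n, ∀ j k : ℕ, j ≤ k →
      ∑ i ∈ Finset.Ico j k, ENNReal.ofReal (dist (w n (i + 1)) (w n i) ^ 2 / (2 * τ n))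
        + (1 / 2) * ∫⁻ t in Ioc (j * τ n) (k * τ n), c n t ^ 2 ≤ ENNReal.ofReal (f n j - f n k))
    {u : ℝ → X}
    (hu : ∀ t, 0 ≤ t → Tendsto (fun n => piecewiseConst (τ n) (w n) t) atTop (𝓝 (u t)))
    {ϕ : ℝ → ℝ} (hϕ : ∀ t ∈ Icc 0 T, Tendsto (fun n => f n ⌈t / τ n⌉₊) atTop (𝓝 (ϕ t))) :
    IsCurveOfMaximalSlope φ₀ T u := by
  have hfanti : ∀ n, Antitone (f n) := fun n => antitone_nat_of_succ_le fun i =>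
    le_trans (le_add_of_nonneg_right (by have := hτ n; positivity)) (hstep n i)
  -- The interpolant stays within twice the last displacement, whose square is at most `2τ(S - L)`.
  have hZu : ∀ t ∈ Ioc 0 T, Tendsto (fun n => Z n t) atTop (𝓝 (u t)) := by
    intro t ht
    have hlim : Tendsto (fun n => √(8 * τ n * (S - L))) atTop (𝓝 0) := by
      have h1 : Tendsto (fun n => 8 * τ n * (S - L)) atTop (𝓝 (8 * 0 * (S - L))) :=
        (hτ0.const_mul 8).mul_const _
      simpa [Function.comp_def] using (Real.continuous_sqrt.tendsto _).comp h1
    refine (tendsto_iff_of_dist (squeeze_zero (fun n => dist_nonneg) (fun n => ?_) hlim)).2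
      (hu t ht.1.le)
    refine Real.le_sqrt_of_sq_le ?_
    have hpos : 0 < ⌈t / τ n⌉₊ := Nat.ceil_pos.2 (div_pos ht.1 (hτ n))
    have h1 := (hZ n t ht.1).2.2.2
    have h2 := hstep n (⌈t / τ n⌉₊ - 1)
    rw [Nat.sub_add_cancel hpos] at h2
    have h3 := hL n t ⟨ht.1.le, ht.2⟩
    have h4 := (hfanti n (Nat.zero_le (⌈t / τ n⌉₊ - 1))).trans (hS n)
    have h5 : dist (w n ⌈t / τ n⌉₊) (w n (⌈t / τ n⌉₊ - 1)) ^ 2 / (2 * τ n) ≤ S - L := by linarith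
    rw [div_le_iff₀ (by linarith [hτ n])] at h5
    calc dist (Z n t) (piecewiseConst (τ n) (w n) t) ^ 2
        ≤ (2 * dist (w n ⌈t / τ n⌉₊) (w n (⌈t / τ n⌉₊ - 1))) ^ 2 :=
          pow_le_pow_left₀ dist_nonneg h1 2
      _ ≤ 8 * τ n * (S - L) := by linarith
  have hslope : ∀ t ∈ Ioc 0 T, descSlope φ₀ (u t) ≤ liminf (fun n => c n t) atTop :=
    fun t ht => hΓ.descSlope_le he he0 hcone (hZu t ht) (hu t ht.1.le)
      (fun n => (hZ n t ht.1).1) (fun n => hf n _) (fun n => (hZ n t ht.1).2.1)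
      (hϕ t ⟨ht.1.le, ht.2⟩) (fun n => (hZ n t ht.1).2.2.1)
  set A : ℝ → ℝ → ℝ≥0∞ := fun s t => liminf (fun n => discreteAction (τ n) (w n) s t) atTop
  have henergy : ∀ s t, 0 ≤ s → s ≤ t → t ≤ T →
      A s t + (1 / 2) * ∫⁻ r in Icc s t, (liminf (fun n => c n r) atTop) ^ 2
        ≤ ENNReal.ofReal (ϕ s - ϕ t) := by
    intro s t hs hst ht
    -- The left endpoint of the grid interval may exceed `s` but tends to it, so each `r` in `(s,
    -- t]` is eventually covered.
    set J : ℕ → Set ℝ := fun n => Ioc (⌈s / τ n⌉₊ * τ n) (⌈t / τ n⌉₊ * τ n)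
    have hfatou : ∫⁻ r in Icc s t, (liminf (fun n => c n r) atTop) ^ 2
        ≤ liminf (fun n => ∫⁻ r in J n, c n r ^ 2) atTop := by
      rw [← restrict_Ioc_eq_restrict_Icc]
      calc ∫⁻ r in Ioc s t, (liminf (fun n => c n r) atTop) ^ 2
          ≤ ∫⁻ r in Ioc s t, liminf (fun n => (J n).indicator (fun r => c n r ^ 2) r) atTop := by
            refine setLIntegral_mono' measurableSet_Ioc fun r hr => ?_
            refine (ENNReal.liminf_sq_le _).trans (liminf_le_liminf ?_)
            filter_upwards [(tendsto_ceil_div_mul hτ hτ0 hs).eventually (gt_mem_nhds hr.1)]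
              with n hn
            rw [indicator_of_mem]
            exact ⟨hn, hr.2.trans ((div_le_iff₀ (hτ n)).1 (Nat.le_ceil _))⟩
        _ ≤ liminf (fun n => ∫⁻ r in Ioc s t, (J n).indicator (fun r => c n r ^ 2) r) atTop :=
            lintegral_liminf_le fun n => ((hc n).pow_const 2).indicator measurableSet_Ioc
        _ ≤ liminf (fun n => ∫⁻ r in J n, c n r ^ 2) atTop := by
            refine liminf_le_liminf (Eventually.of_forall fun n => ?_)
            exact (setLIntegral_le_lintegral _ _).trans_eq (lintegral_indicator measurableSet_Ioc _)
    calc A s t + (1 / 2) * ∫⁻ r in Icc s t, (liminf (fun n => c n r) atTop) ^ 2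
        ≤ A s t + liminf (fun n => (1 / 2) * ∫⁻ r in J n, c n r ^ 2) atTop :=
          add_le_add_right ((mul_le_mul_right hfatou _).trans (ENNReal.mul_liminf_le _ _)) _
      _ ≤ liminf (fun n => discreteAction (τ n) (w n) s t
            + (1 / 2) * ∫⁻ r in J n, c n r ^ 2) atTop := ENNReal.liminf_add_liminf_le _ _
      _ ≤ liminf (fun n => ENNReal.ofReal (f n ⌈s / τ n⌉₊ - f n ⌈t / τ n⌉₊)) atTop :=
          liminf_le_liminf (Eventually.of_forall fun n => hen n _ _ (ceil_div_mono (hτ n) hst))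
      _ = ENNReal.ofReal (ϕ s - ϕ t) :=
          (ENNReal.tendsto_ofReal ((hϕ s ⟨hs, hst.trans ht⟩).sub
            (hϕ t ⟨hs.trans hst, ht⟩))).liminf_eq
  have hAfin : ∀ s t, 0 ≤ s → s ≤ t → t ≤ T → A s t ≠ ⊤ := fun s t hs hst ht =>
    ne_top_of_le_ne_top ENNReal.ofReal_ne_top (le_self_add.trans (henergy s t hs hst ht))
  -- Discrete actions are additive in time, so their liminf `A` is superadditive; the factor `2`
  -- matches `dist² / (2τ)`.
  obtain ⟨m, hm, hmA⟩ := exists_isMetricDerivative_of_sq_dist_le (u := u)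
    (H := fun s t => 2 * (A s t).toReal) hT
    (fun s t _ _ _ => mul_nonneg two_pos.le ENNReal.toReal_nonneg)
    (fun r s t hr hrs hst ht => by
      rw [← mul_add, ← ENNReal.toReal_add (hAfin r s hr hrs (hst.trans ht))
        (hAfin s t (hr.trans hrs) hst ht)]
      refine mul_le_mul_of_nonneg_left (ENNReal.toReal_mono (hAfin r t hr (hrs.trans hst) ht) ?_)
        two_pos.le
      refine (ENNReal.liminf_add_liminf_le _ _).trans_eq ?_
      simp only [A, discreteAction_add (hτ _) _ hrs hst])
    (fun s t hs hst ht => by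
      obtain ⟨k, hkA, hk⟩ := exists_seq_tendsto_liminf
        (u := fun n => discreteAction (τ n) (w n) s t) (f := atTop)
      have h1 := ((((hu s hs).dist (hu t (hs.trans hst))).pow 2).comp hk)
      have h2 := ((((tendsto_ceil_div_mul hτ hτ0 (hs.trans hst)).sub
        (tendsto_ceil_div_mul hτ hτ0 hs)).comp hk).mul
          (((ENNReal.tendsto_toReal (hAfin s t hs hst ht)).comp hkA).const_mul 2))
      exact le_of_tendsto_of_tendsto' h1 h2 fun j =>
        sq_dist_piecewiseConst_le (hτ (k j)) (w (k j)) hst)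
  refine ⟨⟨m, hm.1⟩, m, hm, ϕ, ?_, ?_, ?_⟩
  · intro s hs t ht hst
    exact le_of_tendsto_of_tendsto' (hϕ t ht) (hϕ s hs) fun n =>
      hfanti n (ceil_div_mono (hτ n) hst)
  · intro s t hs hst ht
    refine le_trans (add_le_add ?_ ?_) (henergy s t hs hst ht)
    · refine (mul_le_mul_right (hmA s t hs hst ht) _).trans_eq ?_
      rw [ENNReal.ofReal_mul two_pos.le, ENNReal.ofReal_toReal (hAfin s t hs hst ht),
        ENNReal.ofReal_ofNat, ← mul_assoc, one_div, ENNReal.inv_mul_cancel two_ne_zero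
        ENNReal.ofNat_ne_top, one_mul]
    · refine mul_le_mul_right ?_ _
      rw [← restrict_Ioc_eq_restrict_Icc]
      exact setLIntegral_mono' measurableSet_Ioc fun r hr =>
        pow_le_pow_left' (hslope r ⟨hs.trans_lt hr.1, hr.2.trans ht⟩) 2
  -- Finite total energy makes `liminf c` finite a.e., which is where `φ₀ (u t)` equals `ϕ t`.
  · have hfin : ∫⁻ r in Icc 0 T, (liminf (fun n => c n r) atTop) ^ 2 ≠ ⊤ := by
      intro htop
      have h1 := henergy 0 T le_rfl hT.le le_rfl
      rw [htop, ENNReal.mul_top (by simp), add_top] at h1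
      exact ENNReal.ofReal_ne_top (top_le_iff.1 h1)
    have hae := ae_lt_top ((Measurable.liminf hc).pow_const 2) hfin
    rw [← restrict_Ioc_eq_restrict_Icc] at hae ⊢
    filter_upwards [hae, ae_restrict_mem measurableSet_Ioc] with t h1 ht
    refine hΓ.eq_of_tendsto he he0 hcone (hZu t ht) (hu t ht.1.le)
      (fun n => (hZ n t ht.1).1) (fun n => hf n _) (fun n => (hZ n t ht.1).2.1)
      (hϕ t ⟨ht.1.le, ht.2⟩) (fun n => (hZ n t ht.1).2.2.1) fun htop => ?_
    rw [htop] at h1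
    simp at h1

end MetricSpace

/-! ### Assembly: uniform bounds and extraction -/

theorem IsMinimizingMovement.isCurveOfMaximalSlope {X : Type*} [MetricSpace X]
    {φ : ℝ → X → EReal} {φ₀ : X → EReal} {ustar : X}
    (hbot : ∀ ε : ℝ, 0 < ε → ∀ x, φ ε x ≠ ⊥)
    (hlsc : ∀ ε : ℝ, 0 < ε → LowerSemicontinuous (φ ε))
    {Cstar τstar : ℝ} (hτs : 0 < τstar)
    (hbound : ∀ ε : ℝ, 0 < ε → ∀ v : X,
      (Cstar : EReal) ≤ φ ε v + ((dist v ustar ^ 2 / (2 * τstar) : ℝ) : EReal))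
    (hcompact : ∀ C : ℝ, 0 < C → ∃ K : Set X, IsCompact K ∧ ∀ ε : ℝ, 0 < ε →
      {v : X | dist v ustar ^ 2 ≤ C ∧ ((-C : ℝ) : EReal) ≤ φ ε v ∧ φ ε v ≤ (C : EReal)} ⊆ K)
    (hΓ : GammaConverges φ φ₀) (hcone : ∀ ε : ℝ, 0 < ε → SlopeConeProperty (φ ε))
    {u₀ : ℝ → X} {S S' : ℝ} (hS' : ∀ ε : ℝ, 0 < ε → dist (u₀ ε) ustar ^ 2 ≤ S')
    (hS : ∀ ε : ℝ, 0 < ε → φ ε (u₀ ε) ≤ (S : EReal))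
    {τ : ℝ → ℝ} (hτ : ∀ ε : ℝ, 0 < ε → 0 < τ ε) (hτ0 : Tendsto τ (𝓝[>] 0) (𝓝 0))
    {u : ℝ → X} (hu : IsMinimizingMovement φ τ u₀ u) {T : ℝ} (hT : 0 < T) :
    IsCurveOfMaximalSlope φ₀ T u := by
  obtain ⟨w, hw, e, he, he0, hconv⟩ := hu
  have hew : Tendsto e atTop (𝓝[>] 0) :=
    tendsto_nhdsWithin_iff.2 ⟨he0, Eventually.of_forall he⟩
  have hsmall : ∀ᶠ ε in 𝓝[>] (0 : ℝ), τ ε < min (τstar / 4) 1 :=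
    hτ0.eventually (gt_mem_nhds (by positivity))
  obtain ⟨N, hN⟩ := eventually_atTop.1 (hew.eventually (hw.and hsmall))
  have hN' : ∀ n, IsDiscreteSolution (φ (e (n + N))) (τ (e (n + N))) (u₀ (e (n + N)))
      (w (e (n + N))) ∧ τ (e (n + N)) < min (τstar / 4) 1 := fun n => hN _ (Nat.le_add_left N n)
  have hτ4 : ∀ n, τ (e (n + N)) ≤ τstar / 4 := fun n => (hN' n).2.le.trans (min_le_left _ _)
  have hα : ∀ n, φ (e (n + N)) (u₀ (e (n + N))) =
      ((φ (e (n + N)) (u₀ (e (n + N)))).toReal : EReal) :=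
    fun n => (EReal.coe_toReal (ne_top_of_le_ne_top (EReal.coe_ne_top _) (hS _ (he _)))
      (hbot _ (he _) _)).symm
  choose f hf hstep using fun n => (hN' n).1.exists_energy (hbot _ (he _)) (hα n)
  have hanti : ∀ n, Antitone (f n) := fun n => antitone_nat_of_succ_le fun i =>
    le_trans (le_add_of_nonneg_right (by have := hτ _ (he (n + N)); positivity)) (hstep n i)
  have hfS : ∀ n, f n 0 ≤ S := fun n => by
    have h1 := hS _ (he (n + N))
    rwa [← (hN' n).1.1, hf, EReal.coe_le_coe_iff] at h1
  have hfb : ∀ n i, Cstar ≤ f n i + dist (w (e (n + N)) i) ustar ^ 2 / (2 * τstar) := fun n i => by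
    have h1 := hbound _ (he (n + N)) (w (e (n + N)) i)
    rwa [hf, ← EReal.coe_add, EReal.coe_le_coe_iff] at h1
  -- For `τ ≤ 1` the grid time reached is at most `T + 1`, which makes the Gronwall constant uniform
  -- in `n`.
  set L : ℝ := Cstar - Real.exp ((T + 1) * (8 / τstar)) * (S + S' / τstar - Cstar)
  have hL : ∀ n, ∀ t ∈ Icc 0 T, L ≤ f n ⌈t / τ (e (n + N))⌉₊ := by
    intro n t ht
    have hτn := hτ _ (he (n + N))
    refine le_trans ?_ (energy_lower_bound hτn (hτ4 n) (hstep n) (hfb n) _)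
    have h1 : (⌈t / τ (e (n + N))⌉₊ : ℝ) * τ (e (n + N)) ≤ T + 1 := by
      have h2 := mul_le_mul_of_nonneg_right
        (Nat.ceil_lt_add_one (div_nonneg ht.1 hτn.le)).le hτn.le
      rw [add_mul, one_mul, div_mul_cancel₀ _ hτn.ne'] at h2
      linarith [ht.2, (hN' n).2.le.trans (min_le_right _ _)]
    have h3 : f n 0 + dist (w (e (n + N)) 0) ustar ^ 2 / τstar - Cstar
        ≤ S + S' / τstar - Cstar := by
      have h4 : dist (w (e (n + N)) 0) ustar ^ 2 / τstar ≤ S' / τstar := by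
        rw [(hN' n).1.1]
        exact div_le_div_of_nonneg_right (hS' _ (he _)) hτs.le
      linarith [hfS n]
    have h5 : 0 ≤ f n 0 + dist (w (e (n + N)) 0) ustar ^ 2 / τstar - Cstar := by
      have h6 : dist (w (e (n + N)) 0) ustar ^ 2 / (2 * τstar)
          ≤ dist (w (e (n + N)) 0) ustar ^ 2 / τstar := by
        gcongr; linarith
      linarith [hfb n 0]
    have h7 : (⌈t / τ (e (n + N))⌉₊ : ℝ) * (8 * τ (e (n + N)) / τstar)
        ≤ (T + 1) * (8 / τstar) := by
      calc (⌈t / τ (e (n + N))⌉₊ : ℝ) * (8 * τ (e (n + N)) / τstar)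
          = (⌈t / τ (e (n + N))⌉₊ : ℝ) * τ (e (n + N)) * (8 / τstar) := by ring
        _ ≤ _ := mul_le_mul_of_nonneg_right h1 (by positivity)
    exact sub_le_sub_left (mul_le_mul (Real.exp_le_exp.2 h7) h3 h5 (Real.exp_pos _).le) _
  -- Clamping time to `[0, T]` produces functions antitone and bounded on all of `ℝ`, as Helly's
  -- theorem requires.
  have hclamp : ∀ t, max 0 (min t T) ∈ Icc 0 T := fun t =>
    ⟨le_max_left _ _, max_le hT.le (min_le_right _ _)⟩
  obtain ⟨σ, hσ, ϕ, hϕ⟩ := exists_subseq_tendsto_of_antitone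
    (f := fun n t => f n ⌈max 0 (min t T) / τ (e (n + N))⌉₊) (C := |S| + |L|)
    (fun n s t hst => hanti n (ceil_div_mono (hτ _ (he _))
      (max_le_max le_rfl (min_le_min_right T hst))))
    (fun n t => by
      have h1 := hL n _ (hclamp t)
      have h2 := (hanti n (Nat.zero_le ⌈max 0 (min t T) / τ (e (n + N))⌉₊)).trans (hfS n)
      exact abs_le.2 ⟨by linarith [neg_abs_le L, abs_nonneg S],
        by linarith [le_abs_self S, abs_nonneg L]⟩)
  choose Z b c hc hZ hen using fun n => exists_discrete_interpolation (hlsc _ (he (n + N)))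
    (hbot _ (he _)) hτs (hbound _ (he _))
    (fun C hC => (hcompact C hC).imp fun K hK => ⟨hK.1, hK.2 _ (he _)⟩)
    (hτ _ (he _)) (hτ4 n) (hN' n).1 (hf n) (hstep n)
  have hsub : Tendsto (fun n => σ n + N) atTop atTop :=
    tendsto_atTop_mono (fun n => Nat.le_add_right _ N) hσ.tendsto_atTop
  exact isCurveOfMaximalSlope_of_tendsto hΓ (e := fun n => e (σ n + N)) (fun n => he _)
    (he0.comp hsub) (fun n => hcone _ (he _)) (τ := fun n => τ (e (σ n + N)))
    (fun n => hτ _ (he _)) (hτ0.comp (hew.comp hsub)) (fun n => hf (σ n)) (fun n => hstep (σ n))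
    hT (fun n => hfS (σ n)) (fun n => hL (σ n)) (fun n => hc (σ n)) (fun n => hZ (σ n))
    (fun n => hen (σ n)) (fun t ht => (hconv t ht).comp hsub) (ϕ := ϕ) fun t ht => by
      have h1 := hϕ t
      rwa [min_eq_left ht.2, max_eq_right ht.1] at h1

theorem corollary1 {X : Type*} [MetricSpace X] [CompleteSpace X]
    (φ : ℝ → X → EReal) (φ₀ : X → EReal) (ustar : X)
    -- `φ ε` takes values in `(-∞, +∞]`
    (hbot : ∀ ε : ℝ, 0 < ε → ∀ x, φ ε x ≠ ⊥)
    -- (i)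
    (hlsc : ∀ ε : ℝ, 0 < ε → LowerSemicontinuous (φ ε))
    -- (ii)
    (hbound : ∃ Cstar τstar : ℝ, 0 < τstar ∧ ∀ ε : ℝ, 0 < ε → ∀ v : X,
      (Cstar : EReal) ≤ φ ε v + ((dist v ustar ^ 2 / (2 * τstar) : ℝ) : EReal))
    -- (iii)
    (hcompact : ∀ C : ℝ, 0 < C → ∃ K : Set X, IsCompact K ∧ ∀ ε : ℝ, 0 < ε →
      {v : X | dist v ustar ^ 2 ≤ C ∧ ((-C : ℝ) : EReal) ≤ φ ε v ∧ φ ε v ≤ (C : EReal)} ⊆ K)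
    (hGamma : GammaConverges φ φ₀) :
    ((∀ ε : ℝ, 0 < ε → SlopeConeProperty (φ ε)) →
      ∀ (u₀ : ℝ → X) (S S' : ℝ),
        (∀ ε : ℝ, 0 < ε → dist (u₀ ε) ustar ^ 2 ≤ S') →
        (∀ ε : ℝ, 0 < ε → ((-S : ℝ) : EReal) ≤ φ ε (u₀ ε) ∧ φ ε (u₀ ε) ≤ (S : EReal)) →
        ∀ τ : ℝ → ℝ, (∀ ε : ℝ, 0 < ε → 0 < τ ε) → Tendsto τ (𝓝[>] 0) (𝓝 0) →
          ∀ u : ℝ → X, IsMinimizingMovement φ τ u₀ u →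
            ∀ T : ℝ, 0 < T → IsCurveOfMaximalSlope φ₀ T u) ∧
    -- convex functions have the Slope Cone Property, so the above applies to them
    (∀ ψ : X → EReal, (∀ x, ψ x ≠ ⊥) → IsGeodesicallyConvex ψ → SlopeConeProperty ψ) := by
  obtain ⟨Cstar, τstar, hτs, hb⟩ := hbound
  refine ⟨fun hcone u₀ S S' hS' hS τ hτ hτ0 u hu T hT => ?_,
    fun ψ hψ hconv => slopeConeProperty_of_isGeodesicallyConvex hψ hconv⟩
  exact hu.isCurveOfMaximalSlope hbot hlsc hτs hb hcompact hGamma hcone hS'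
    (fun ε hε => (hS ε hε).2) hτ hτ0 hT
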